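/- **Continuous RSK.** To a non-negative real $m\times n$ matrix $[x_{i,j}]$ (row index $i$, column index $j$, first site $(1,1)$) associate, for each level $l=1,2,\dots$, profiles $h_l(t,\cdot):\mathbb Z\to\mathbb R$, $t=0,1,2,\dots$, with $h_l(0,\cdot)=0$, by the following growth process. In the step from $t-1$ to $t$ every profile grows one unit to the left and to the right, and new columns of unit width are put on top: $$h_l(t,x)=\max\{h_l(t-1,x-1),h_l(t-1,x),h_l(t-1,x+1)\}+\omega_l(t,x).$$ At level 1, $\omega_1(t,x)=x_{i,j}$ if $i+j-1=t$ and $j-i=x$ for some site $(i,j)$ of the matrix, and $\omega_1(t,x)=0$ otherwise; at level $l+1$, $\omega_{l+1}(t,x)=\max\{0,\min\{h_l(t-1,x-1),h_l(t-1,x+1)\}-h_l(t-1,x)\}$ is the overlap occurring at level $l$ in this step. The level-$l$ path is the profile $h_l(T,\cdot)$ at the final time $T=2\max(m,n)-1$, and $\max_x h_l(T,x)$ is the maximum displacement at level $l$. **Proposition.** Let $a>0$ and $a+a_1>0$. Empty products are $1$; in particular $\prod_{l=1}^{m}l!=1$ for $m\le 0$. *First*, let $[x_{i,j}]$ be a random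 symmetric $n\times n$ matrix ($x_{i,j}=x_{j,i}$) whose entries with $i\le j$ are independent and exponentially distributed, with rate $2a$ for $i<j$ and rate $a+a_1$ for $i=j$. Then the maximum displacements $x_l$ at levels $l=1,\dots,n$ under continuous RSK have joint PDF $$\frac{(a+a_1)^n(2a)^{n(n-1)/2}}{\prod_{l=1}^{n-1}l!}\,e^{-a\sum_{j=1}^n x_j}\,e^{-a_1\sum_{j=1}^n(-1)^{j-1}x_j}\prod_{1\le i<j\le n}(x_i-x_j),\qquad x_1>x_2>\cdots>x_n>0$$ (and $0$ elsewhere), and almost surely the displacements at all levels $l>n$ are $0$. For $n$ replaced by $2n$ this is equivalent to the ensemble $$\frac1C\prod_{j=1}^{2n}e^{-x_j/2}\prod_{j=1}^n e^{A(x_{2j-1}-x_{2j})/2}\prod_{1\le j<k\le 2n}(x_j-x_k),\qquad x_1>x_2>\cdots>x_{2n}\ge0,$$ with $A=-a_1/a$ and $C$ a normalization constant: this is the joint PDF of the displacements multiplied by $2a$. *Second*, let $[x_{i,j}]$ be a random $n_1\times(n_2+1)$ matrix with independent exponentially distributed entries, of rate $2a$ for $j\ne n_2+1$ and rate $a+a_1$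 for $j=n_2+1$. Let $x_l$ be the maximum displacement at level $l$ of the whole matrix and $y_l$ that of the $n_1\times n_2$ matrix of its first $n_2$ columns. (i) If $n_2\ge n_1$, the joint PDF of $x_1,\dots,x_{n_1},y_1,\dots,y_{n_1}$ is non-zero if and only if $x_1>y_1>x_2>y_2>\cdots>x_{n_1}>y_{n_1}>0$, and then equals $$\frac{(2a)^{n_1n_2}(a+a_1)^{n_1}\prod_{l=1}^{n_2-n_1-1}l!}{\prod_{l=1}^{n_1-1}l!\prod_{l=1}^{n_2-1}l!}\,e^{-a\sum_{j=1}^{n_1}(x_j+y_j)}e^{-a_1\sum_{j=1}^{n_1}(x_j-y_j)}\prod_{i=1}^{n_1}y_i^{n_2-n_1}\prod_{1\le i<j\le n_1}(x_i-x_j)(y_i-y_j);$$ almost surely all further displacements $x_l,y_l$, $l>n_1$, are $0$. If $n_1=n_2=n$, this is equivalent to the ensemble $$\frac1C\prod_{j=1}^{2n}e^{-x_j/2}\prod_{j=1}^n e^{A(x_{2j-1}-x_{2j})/2}\prod_{1\le j<k\le n}(x_{2j-1}-x_{2k-1})(x_{2k}-x_{2j}),\qquad x_1>x_2>\cdots>x_{2n}\ge0,$$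 with $A=-a_1/a$ and $C$ a normalization constant (of sign $(-1)^{n(n-1)/2}$): this is the joint PDF of the vector $2a\,(x_1,y_1,x_2,y_2,\dots,x_n,y_n)$. (ii) If $n_2<n_1$, the joint PDF of $x_1,\dots,x_{n_2+1},y_1,\dots,y_{n_2}$ is non-zero if and only if $x_1>y_1>x_2>y_2>\cdots>x_{n_2}>y_{n_2}>x_{n_2+1}>0$, and then equals $$\frac{(2a)^{n_1n_2}(a+a_1)^{n_1}\prod_{l=1}^{n_1-n_2-2}l!}{\prod_{l=1}^{n_1-1}l!\prod_{l=1}^{n_2-1}l!}\,e^{-a\sum_{j=1}^{n_2}(x_j+y_j)}e^{-a_1\sum_{j=1}^{n_2}(x_j-y_j)}e^{-(a+a_1)x_{n_2+1}}\prod_{i=1}^{n_2+1}x_i^{n_1-n_2-1}\prod_{1\le i<j\le n_2+1}(x_i-x_j)\prod_{1\le i<j\le n_2}(y_i-y_j);$$ almost surely all further displacements $x_l$, $l>n_2+1$, and $y_l$, $l>n_2$, are $0$. -/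

import Mathlib

open MeasureTheory ProbabilityTheory

noncomputable section

namespace ContinuousRSK

/-! ### The continuous RSK correspondence as a cascade of growth models

A matrix `X` is indexed by `(i, j)`, where `i` is the row, counted from the bottom, and `j` the
column; the indices start at `0` here, so that the first site is `(0, 0)`. -/

/-- Heights of the nucleation events of the matrix `X` at time `t`, as a function of the
position: with zero-based indices the entry `X i j` nucleates at time `i + j + 1` (so `X 0 0`
does at time `1`), centred at the position `j - i`. -/
def nucleation {m n : ℕ} (X : Fin m → Fin n → ℝ) (t : ℕ) (x : ℤ) : ℝ :=
  ∑ i : Fin m, ∑ j : Fin n,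
    if (i : ℕ) + (j : ℕ) + 1 = t ∧ (j : ℤ) - (i : ℤ) = x then X i j else 0

/-- A profile (`h x` is the height of the unit-width column centred at the integer `x`) after
growing by one unit to the left and one unit to the right. -/
def grow (h : ℤ → ℝ) (x : ℤ) : ℝ := max (h x) (max (h (x - 1)) (h (x + 1)))

/-- Height of the overlap which occurs at `x` when the profile `h` grows by one unit in both
directions: the part growing from the left covers the column at `x` up to the height `h (x - 1)`,
the part growing from the right up to `h (x + 1)`, and the column was filled up to `h x`. -/
def overlap (h : ℤ → ℝ) (x : ℤ) : ℝ := max 0 (min (h (x - 1)) (h (x + 1)) - h x)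

/-- `profile X t l` is the profile at time `t` at the level `l + 1` (levels start at `0` here);
each level is drawn with respect to its own base line. All profiles start flat. In each time
step each profile grows; on top of it are then put, on the first level, the nucleation events of
`X`, and, on each further level, the overlaps that occurred in the growth of the level above. -/
def profile {m n : ℕ} (X : Fin m → Fin n → ℝ) : ℕ → ℕ → ℤ → ℝ
  | 0, _, _ => 0
  | t + 1, 0, x => grow (profile X t 0) x + nucleation X (t + 1) x
  | t + 1, l + 1, x => grow (profile X t (l + 1)) x + overlap (profile X t l) x

/-- Maximum displacement of the level-`(l + 1)` path associated with the `m × n` matrix `X`. The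
path is the profile at the final time `2 N - 1`, `N = max m n`, at which the last entry of the
`N × N` matrix obtained by appending zero rows or columns to `X` nucleates. -/
def displacement {m n : ℕ} (X : Fin m → Fin n → ℝ) (l : ℕ) : ℝ :=
  ⨆ x : ℤ, profile X (2 * max m n - 1) l x

/-! ### The random matrices -/

/-- `X` is a random symmetric `n × n` matrix, whose entries on and on one side of the diagonal
are independent, exponential with rate `2a` off the diagonal and `a + a₁` on it. -/
structure IsSymmExpMatrix {Ω : Type*} [MeasurableSpace Ω] (P : Measure Ω) (a a₁ : ℝ) {n : ℕ}
    (X : Fin n → Fin n → Ω → ℝ) : Prop where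
  offDiag : ∀ i j, i < j → HasLaw (X i j) (expMeasure (2 * a)) P
  diag : ∀ i, HasLaw (X i i) (expMeasure (a + a₁)) P
  indep : iIndepFun (fun p : {p : Fin n × Fin n // p.1 ≤ p.2} => X p.1.1 p.1.2) P
  symm : ∀ i j, X i j = X j i

/-- `X` is a random `n₁ × (n₂ + 1)` matrix with independent entries, exponential with rate
`a + a₁` in the last column and `2a` in the others. -/
structure IsRectExpMatrix {Ω : Type*} [MeasurableSpace Ω] (P : Measure Ω) (a a₁ : ℝ)
    {n₁ n₂ : ℕ} (X : Fin n₁ → Fin (n₂ + 1) → Ω → ℝ) : Prop where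
  bulk : ∀ i (j : Fin n₂), HasLaw (X i j.castSucc) (expMeasure (2 * a)) P
  last : ∀ i, HasLaw (X i (Fin.last n₂)) (expMeasure (a + a₁)) P
  indep : iIndepFun (fun p : Fin n₁ × Fin (n₂ + 1) => X p.1 p.2) P

/-! ### The densities -/

/-- `∏_{l=1}^m l!` -/
def superfact (m : ℕ) : ℝ := ∏ l ∈ Finset.Icc 1 m, (Nat.factorial l : ℝ)

/-- `∏_{i<j} (x_i - x_j)` -/
def diffProd {n : ℕ} (x : Fin n → ℝ) : ℝ := ∏ i, ∏ j ∈ Finset.Ioi i, (x i - x j)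

/-- The density of the displacements in the symmetric case, supported on
`x_1 > x_2 > ⋯ > x_n > 0`. -/
def symmDensity (a a₁ : ℝ) (n : ℕ) : (Fin n → ℝ) → ℝ :=
  Set.indicator {x | StrictAnti x ∧ ∀ i, 0 < x i} fun x =>
    (a + a₁) ^ n * (2 * a) ^ (n * (n - 1) / 2) / superfact (n - 1)
      * Real.exp (-a * ∑ j, x j) * Real.exp (-a₁ * ∑ j : Fin n, (-1) ^ (j : ℕ) * x j)
      * diffProd x

/-- `x_1 > y_1 > x_2 > y_2 > ⋯ > x_n > y_n > 0` -/
def Interlaced {n : ℕ} (x y : Fin n → ℝ) : Prop :=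
  (∀ i, y i < x i) ∧ (∀ i j : Fin n, (i : ℕ) + 1 = j → x j < y i) ∧ ∀ i, 0 < y i

/-- `x_1 > y_1 > x_2 > y_2 > ⋯ > x_n > y_n > x_{n+1} > 0` -/
def InterlacedSucc {n : ℕ} (x : Fin (n + 1) → ℝ) (y : Fin n → ℝ) : Prop :=
  (∀ i : Fin n, y i < x i.castSucc) ∧ (∀ i : Fin n, x i.succ < y i) ∧ 0 < x (Fin.last n)

/-- The joint density for an `n₁ × (n₂ + 1)` matrix with `n₁ ≤ n₂`. -/
def wideDensity (a a₁ : ℝ) (n₁ n₂ : ℕ) : (Fin n₁ → ℝ) × (Fin n₁ → ℝ) → ℝ :=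
  Set.indicator {p | Interlaced p.1 p.2} fun p =>
    (2 * a) ^ (n₁ * n₂) * (a + a₁) ^ n₁ * superfact (n₂ - n₁ - 1)
        / (superfact (n₁ - 1) * superfact (n₂ - 1))
      * Real.exp (-a * ∑ j, (p.1 j + p.2 j)) * Real.exp (-a₁ * ∑ j, (p.1 j - p.2 j))
      * (∏ i, p.2 i ^ (n₂ - n₁)) * (diffProd p.1 * diffProd p.2)

/-- The joint density for an `n₁ × (n₂ + 1)` matrix with `n₂ < n₁`. -/
def tallDensity (a a₁ : ℝ) (n₁ n₂ : ℕ) : (Fin (n₂ + 1) → ℝ) × (Fin n₂ → ℝ) → ℝ :=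
  Set.indicator {p | InterlacedSucc p.1 p.2} fun p =>
    (2 * a) ^ (n₁ * n₂) * (a + a₁) ^ n₁ * superfact (n₁ - n₂ - 2)
        / (superfact (n₁ - 1) * superfact (n₂ - 1))
      * Real.exp (-a * ∑ j : Fin n₂, (p.1 j.castSucc + p.2 j))
      * Real.exp (-a₁ * ∑ j : Fin n₂, (p.1 j.castSucc - p.2 j))
      * Real.exp (-(a + a₁) * p.1 (Fin.last n₂))
      * (∏ i, p.1 i ^ (n₁ - n₂ - 1)) * (diffProd p.1 * diffProd p.2)

/-- The coordinates `x_1, x_3, …, x_{2n-1}` of `x_1, …, x_{2n}`. -/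
def oddPart {n : ℕ} (x : Fin (2 * n) → ℝ) (j : Fin n) : ℝ := x ⟨2 * j, by omega⟩

/-- The coordinates `x_2, x_4, …, x_{2n}` of `x_1, …, x_{2n}`. -/
def evenPart {n : ℕ} (x : Fin (2 * n) → ℝ) (j : Fin n) : ℝ := x ⟨2 * j + 1, by omega⟩

/-- The parameter dependent ensemble on `x_1 > ⋯ > x_{2n} ≥ 0`, without its normalization,
interpolating between orthogonal and symplectic symmetry. -/
def orthSympWeight (A : ℝ) (n : ℕ) : (Fin (2 * n) → ℝ) → ℝ :=
  Set.indicator {x | StrictAnti x ∧ ∀ i, 0 ≤ x i} fun x =>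
    (∏ j, Real.exp (-x j / 2))
      * (∏ j : Fin n, Real.exp (A * (oddPart x j - evenPart x j) / 2)) * diffProd x

/-- The parameter dependent ensemble on `x_1 > ⋯ > x_{2n} ≥ 0`, without its normalization,
interpolating between superimposed orthogonal and unitary symmetry. Its last product is
`∏_{j<k} (x_{2j-1} - x_{2k-1}) (x_{2k} - x_{2j})`, so the weight has the constant sign
`(-1)^{n(n-1)/2}`, which the normalization compensates. -/
def orthUnitWeight (A : ℝ) (n : ℕ) : (Fin (2 * n) → ℝ) → ℝ :=
  Set.indicator {x | StrictAnti x ∧ ∀ i, 0 ≤ x i} fun x =>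
    (∏ j, Real.exp (-x j / 2))
      * (∏ j : Fin n, Real.exp (A * (oddPart x j - evenPart x j) / 2))
      * ∏ j : Fin n, ∏ k ∈ Finset.Ioi j,
          (oddPart x j - oddPart x k) * (evenPart x k - evenPart x j)

/-- The random vector `Y` has the probability density function `f` with respect to Lebesgue
measure. -/
def HasDensity {Ω E : Type*} [MeasurableSpace Ω] [MeasureSpace E] (P : Measure Ω) (Y : Ω → E)
    (f : E → ℝ) : Prop :=
  HasLaw Y ((volume : Measure E).withDensity fun y => ENNReal.ofReal (f y)) P

/-- The vector `x_1, y_1, x_2, y_2, …, x_n, y_n`. -/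
def interleave {n : ℕ} (x y : ℕ → ℝ) (k : Fin (2 * n)) : ℝ :=
  if (k : ℕ) % 2 = 0 then x ((k : ℕ) / 2) else y ((k : ℕ) / 2)

end ContinuousRSK

end

open ContinuousRSK

noncomputable section

namespace ContinuousRSK

/-! ### Shapes of the local growth rule -/

/-- `lam X i j` is the sequence of level heights attached to the `i × j` corner of the array `X` by
the local growth rule; the levels from `min i j` on are empty. -/
def lam (X : ℕ → ℕ → ℝ) : ℕ → ℕ → ℕ → ℝ
  | 0, _, _ => 0
  | _ + 1, 0, _ => 0
  | i + 1, j + 1, 0 => max (lam X i (j + 1) 0) (lam X (i + 1) j 0) + X i j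
  | i + 1, j + 1, l + 1 => if l < min i j then
      max (lam X i (j + 1) (l + 1)) (lam X (i + 1) j (l + 1))
      + min (lam X i (j + 1) l) (lam X (i + 1) j l) - lam X i j l else 0

@[simp] lemma lam_zero_left (X : ℕ → ℕ → ℝ) (j l : ℕ) : lam X 0 j l = 0 := by
  simp [lam]

@[simp] lemma lam_zero_right (X : ℕ → ℕ → ℝ) (i l : ℕ) : lam X i 0 l = 0 := by
  cases i <;> simp [lam]

lemma lam_succ_zero (X : ℕ → ℕ → ℝ) (i j : ℕ) :
    lam X (i + 1) (j + 1) 0 = max (lam X i (j + 1) 0) (lam X (i + 1) j 0) + X i j := by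
  rw [lam]

lemma lam_succ_succ (X : ℕ → ℕ → ℝ) {i j l : ℕ} (h : l < min i j) :
    lam X (i + 1) (j + 1) (l + 1) = max (lam X i (j + 1) (l + 1)) (lam X (i + 1) j (l + 1))
      + min (lam X i (j + 1) l) (lam X (i + 1) j l) - lam X i j l := by
  rw [lam, if_pos h]

lemma lam_eq_zero_of_le (X : ℕ → ℕ → ℝ) (i j l : ℕ) (h : min i j ≤ l) : lam X i j l = 0 := by
  rcases i with _ | i
  · simp
  rcases j with _ | j
  · simp
  rcases l with _ | l
  · omega
  rw [lam, if_neg (by omega)]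

/-- `u ≺ v`: the sequences `u` and `v` interlace weakly, `v` being the larger one. -/
def Prec (u v : ℕ → ℝ) : Prop := ∀ l, v (l + 1) ≤ u l ∧ u l ≤ v l

lemma prec_corner_iff {a b u v : ℕ → ℝ} {w : ℝ} (h0 : v 0 = max (a 0) (b 0) + w)
    (hs : ∀ l, v (l + 1) = max (a (l + 1)) (b (l + 1)) + min (a l) (b l) - u l ∨
      (v (l + 1) = 0 ∧ u l = 0 ∧ a (l + 1) = 0 ∧ b (l + 1) = 0)) :
    (Prec a v ∧ Prec b v) ↔ (0 ≤ w ∧ Prec u a ∧ Prec u b) := by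
  constructor
  · rintro ⟨ha, hb⟩
    refine ⟨?_, fun l => ?_, fun l => ?_⟩
    · have h1 := (ha 0).2
      have h2 := (hb 0).2
      have := max_le h1 h2
      linarith
    all_goals
      have h1 := (ha l).1
      have h2 := (hb l).1
      have h3 := (ha (l + 1)).2
      have h4 := (hb (l + 1)).2
      have h5 := le_min h1 h2
      have h6 := max_le h3 h4
      have h7 := min_le_left (a l) (b l)
      have h8 := min_le_right (a l) (b l)
      have h9 := le_max_left (a (l + 1)) (b (l + 1))
      have h10 := le_max_right (a (l + 1)) (b (l + 1))
      rcases hs l with h | ⟨e1, e2, e3, e4⟩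
      · constructor <;> linarith
      · constructor <;> linarith
  · rintro ⟨hw, ha, hb⟩
    have key : ∀ l, v (l + 1) ≤ min (a l) (b l) ∧ max (a (l + 1)) (b (l + 1)) ≤ v (l + 1) := by
      intro l
      have h1 := le_min (ha l).2 (hb l).2
      have h2 := max_le (ha l).1 (hb l).1
      rcases hs l with h | ⟨e1, e2, e3, e4⟩
      · constructor <;> linarith
      · rw [e3, e4, max_self] at *
        constructor <;> linarith
    refine ⟨fun l => ⟨(key l).1.trans (min_le_left _ _), ?_⟩,
      fun l => ⟨(key l).1.trans (min_le_right _ _), ?_⟩⟩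
    · rcases l with _ | l
      · have := le_max_left (a 0) (b 0)
        linarith
      · exact (le_max_left _ _).trans (key l).2
    · rcases l with _ | l
      · have := le_max_right (a 0) (b 0)
        linarith
      · exact (le_max_right _ _).trans (key l).2

lemma lam_corner_iff (X : ℕ → ℕ → ℝ) (i j : ℕ) :
    (Prec (lam X i (j + 1)) (lam X (i + 1) (j + 1)) ∧
      Prec (lam X (i + 1) j) (lam X (i + 1) (j + 1))) ↔
    (0 ≤ X i j ∧ Prec (lam X i j) (lam X i (j + 1)) ∧ Prec (lam X i j) (lam X (i + 1) j)) := by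
  refine prec_corner_iff (lam_succ_zero X i j) fun l => ?_
  rcases lt_or_ge l (min i j) with h | h
  · exact Or.inl (lam_succ_succ X h)
  · right
    refine ⟨?_, ?_, ?_, ?_⟩ <;> apply lam_eq_zero_of_le <;> omega

lemma prec_zero : Prec (0 : ℕ → ℝ) 0 := fun _ => ⟨le_rfl, le_rfl⟩

/-- An array is nonnegative on an `m × n` rectangle if and only if the shapes along the two outer
sides of the rectangle interlace. -/
lemma prec_boundary_iff (X : ℕ → ℕ → ℝ) (m n : ℕ) :
    ((∀ q < m, Prec (lam X q n) (lam X (q + 1) n)) ∧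
      (∀ q < n, Prec (lam X m q) (lam X m (q + 1)))) ↔ ∀ i < m, ∀ j < n, 0 ≤ X i j := by
  constructor
  · rintro ⟨hv, hh⟩
    have key : ∀ d i j, i ≤ m → j ≤ n → m - i + (n - j) = d →
        (∀ q, q + 1 = i → Prec (lam X q j) (lam X i j)) ∧
        (∀ q, q + 1 = j → Prec (lam X i q) (lam X i j)) := by
      intro d
      induction d with
      | zero =>
        intro i j hi hj hd
        obtain rfl : i = m := by omega
        obtain rfl : j = n := by omega
        exact ⟨fun q hq => by subst hq; exact hv q (by omega),
          fun q hq => by subst hq; exact hh q (by omega)⟩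
      | succ d ih =>
        intro i j hi hj hd
        constructor
        · intro q hq
          subst hq
          rcases eq_or_lt_of_le hj with rfl | hj'
          · exact hv q (by omega)
          · have h := ih (q + 1) (j + 1) hi (by omega) (by omega)
            exact ((lam_corner_iff X q j).1 ⟨h.1 q rfl, h.2 j rfl⟩).2.2
        · intro q hq
          subst hq
          rcases eq_or_lt_of_le hi with rfl | hi'
          · exact hh q (by omega)
          · have h := ih (i + 1) (q + 1) (by omega) hj (by omega)
            exact ((lam_corner_iff X i q).1 ⟨h.1 i rfl, h.2 q rfl⟩).2.1
    intro i hi j hj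
    have h := key _ (i + 1) (j + 1) hi hj rfl
    exact ((lam_corner_iff X i j).1 ⟨h.1 i rfl, h.2 j rfl⟩).1
  · intro hX
    have key : ∀ i j, i ≤ m → j ≤ n →
        (∀ q, q + 1 = i → Prec (lam X q j) (lam X i j)) ∧
        (∀ q, q + 1 = j → Prec (lam X i q) (lam X i j)) := by
      intro i
      induction i with
      | zero =>
        intro j _ _
        exact ⟨fun q hq => by omega, fun q _ l => by simp⟩
      | succ i ihi =>
        intro j
        induction j with
        | zero =>
          intro _ _
          exact ⟨fun q _ l => by simp, fun q hq => by omega⟩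
        | succ j ihj =>
          intro hi hj
          have h := (lam_corner_iff X i j).2 ⟨hX i hi j hj,
            (ihi (j + 1) (by omega) hj).2 j rfl, (ihj hi (by omega)).1 i rfl⟩
          exact ⟨fun q hq => by obtain rfl : q = i := by omega
                                exact h.1,
            fun q hq => by obtain rfl : q = j := by omega
                           exact h.2⟩
    exact ⟨fun q hq => (key (q + 1) n hq le_rfl).1 q rfl,
      fun q hq => (key m (q + 1) le_rfl hq).2 q rfl⟩

lemma lam_congr {X Y : ℕ → ℕ → ℝ} {m n : ℕ} (h : ∀ i < m, ∀ j < n, X i j = Y i j) :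
    ∀ i ≤ m, ∀ j ≤ n, ∀ l, lam X i j l = lam Y i j l := by
  intro i
  induction i with
  | zero => simp
  | succ i ihi =>
    intro hi j
    induction j with
    | zero => simp
    | succ j ihj =>
      intro hj l
      have e1 := ihi (by omega) (j + 1) hj
      have e2 := ihj (by omega)
      have e3 := ihi (by omega) j (by omega)
      rcases l with _ | l
      · simp only [lam_succ_zero, e1, e2, h i (by omega) j (by omega)]
      · simp only [lam, e1, e2, e3]

lemma lam_swap (X : ℕ → ℕ → ℝ) (i j l : ℕ) :
    lam (fun i j => X j i) i j l = lam X j i l := by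
  induction i generalizing j l with
  | zero => simp
  | succ i ihi =>
    induction j generalizing l with
    | zero => simp
    | succ j ihj =>
      rcases l with _ | l
      · rw [lam_succ_zero, lam_succ_zero, ihi, ihj, max_comm]
      · simp only [lam]
        rw [ihi, ihj, ihi, ihj, ihi, max_comm,
          min_comm (lam X (j + 1) i l), min_comm i j]

section Nonneg

variable {X : ℕ → ℕ → ℝ} (hX : ∀ i j, 0 ≤ X i j)
include hX

lemma lam_prec_left (i j : ℕ) : Prec (lam X i j) (lam X (i + 1) j) :=
  ((prec_boundary_iff X (i + 1) j).2 fun _ _ _ _ => hX _ _).1 i (by omega)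

lemma lam_prec_right (i j : ℕ) : Prec (lam X i j) (lam X i (j + 1)) :=
  ((prec_boundary_iff X i (j + 1)).2 fun _ _ _ _ => hX _ _).2 j (by omega)

lemma lam_nonneg (i j l : ℕ) : 0 ≤ lam X i j l := by
  have anti : Antitone (lam X i j) := antitone_nat_of_succ_le fun l => by
    rcases i with _ | i
    · simp
    · exact (lam_prec_left hX i j l).1.trans (lam_prec_left hX i j l).2
  have h := anti (le_max_left l (min i j))
  rwa [lam_eq_zero_of_le X i j _ (le_max_right _ _)] at h

lemma lam_succ_succ_of_nonneg (i j l : ℕ) :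
    lam X (i + 1) (j + 1) (l + 1) = max (lam X i (j + 1) (l + 1)) (lam X (i + 1) j (l + 1))
      + min (lam X i (j + 1) l) (lam X (i + 1) j l) - lam X i j l := by
  rcases lt_or_ge l (min i j) with h | h
  · exact lam_succ_succ X h
  · rw [lam_eq_zero_of_le X (i + 1) (j + 1) (l + 1) (by omega),
      lam_eq_zero_of_le X i (j + 1) (l + 1) (by omega),
      lam_eq_zero_of_le X (i + 1) j (l + 1) (by omega), lam_eq_zero_of_le X i j l h]
    have h1 := lam_nonneg hX i (j + 1) l
    have h2 := lam_nonneg hX (i + 1) j l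
    rcases le_total i j with hij | hij
    · rw [lam_eq_zero_of_le X i (j + 1) l (by omega)]
      simp [h2]
    · rw [lam_eq_zero_of_le X (i + 1) j l (by omega)]
      simp [h1]

lemma lam_mono {i i' j j' : ℕ} (hi : i ≤ i') (hj : j ≤ j') (l : ℕ) :
    lam X i j l ≤ lam X i' j' l :=
  (monotone_nat_of_le_succ (fun i => (lam_prec_left hX i j l).2) hi).trans
    (monotone_nat_of_le_succ (fun j => (lam_prec_right hX i' j l).2) hj)

lemma lam_add_column (i j : ℕ) (h0 : ∀ i, X i j = 0) (l : ℕ) :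
    lam X i (j + 1) l = lam X i j l := by
  induction i generalizing l with
  | zero => simp
  | succ i ih =>
    rcases l with _ | l
    · rw [lam_succ_zero, ih, h0, add_zero]
      exact max_eq_right (lam_prec_left hX i j 0).2
    · rw [lam_succ_succ_of_nonneg hX, ih, ih,
        max_eq_right (lam_prec_left hX i j (l + 1)).2, min_eq_left (lam_prec_left hX i j l).2]
      ring

lemma lam_add_columns (i n j : ℕ) (h0 : ∀ i, ∀ j ≥ n, X i j = 0) (hj : n ≤ j) (l : ℕ) :
    lam X i j l = lam X i n l := by
  induction j, hj using Nat.le_induction with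
  | base => rfl
  | succ j hj ih => rw [lam_add_column hX i j (fun i => h0 i j hj), ih]

lemma lam_add_rows (m i j : ℕ) (h0 : ∀ i ≥ m, ∀ j, X i j = 0) (hi : m ≤ i) (l : ℕ) :
    lam X i j l = lam X m j l := by
  rw [← lam_swap, ← lam_swap X j m]
  exact lam_add_columns (fun _ _ => hX _ _) j m i (fun a b hb => h0 b hb a) hi l

lemma lam_le_of_support (m n i j : ℕ) (h1 : ∀ i ≥ m, ∀ j, X i j = 0)
    (h2 : ∀ i, ∀ j ≥ n, X i j = 0) (l : ℕ) : lam X i j l ≤ lam X m n l := by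
  refine (lam_mono hX (le_max_left i m) (le_max_left j n) l).trans_eq ?_
  rw [lam_add_columns hX _ n _ h2 (le_max_right _ _), lam_add_rows hX m _ _ h1 (le_max_right _ _)]

lemma sum_lam_corner (i j : ℕ) {L : ℕ} (hL : min i j < L) :
    ∑ l ∈ Finset.range L, lam X (i + 1) (j + 1) l + ∑ l ∈ Finset.range L, lam X i j l =
      ∑ l ∈ Finset.range L, lam X i (j + 1) l + ∑ l ∈ Finset.range L, lam X (i + 1) j l
        + X i j := by
  obtain ⟨L, rfl⟩ : ∃ k, L = k + 1 := ⟨L - 1, by omega⟩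
  have e : ∑ l ∈ Finset.range L, lam X (i + 1) (j + 1) (l + 1) =
      ∑ l ∈ Finset.range L, max (lam X i (j + 1) (l + 1)) (lam X (i + 1) j (l + 1)) +
      ∑ l ∈ Finset.range L, min (lam X i (j + 1) l) (lam X (i + 1) j l) -
      ∑ l ∈ Finset.range L, lam X i j l := by
    rw [← Finset.sum_add_distrib, ← Finset.sum_sub_distrib]
    exact Finset.sum_congr rfl fun l _ => lam_succ_succ_of_nonneg hX i j l
  have e2 : min (lam X i (j + 1) L) (lam X (i + 1) j L) = 0 := by
    rcases le_total i j with hij | hij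
    · rw [lam_eq_zero_of_le X i (j + 1) L (by omega)]
      simp [lam_nonneg hX]
    · rw [lam_eq_zero_of_le X (i + 1) j L (by omega)]
      simp [lam_nonneg hX]
  have e3 : ∑ l ∈ Finset.range (L + 1), max (lam X i (j + 1) l) (lam X (i + 1) j l) +
      ∑ l ∈ Finset.range (L + 1), min (lam X i (j + 1) l) (lam X (i + 1) j l) =
      ∑ l ∈ Finset.range (L + 1), lam X i (j + 1) l +
        ∑ l ∈ Finset.range (L + 1), lam X (i + 1) j l := by
    rw [← Finset.sum_add_distrib, ← Finset.sum_add_distrib]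
    exact Finset.sum_congr rfl fun l _ => max_add_min _ _
  rw [← e3, Finset.sum_range_succ', e, lam_succ_zero, Finset.sum_range_succ (fun l => lam X i j l),
    lam_eq_zero_of_le X i j L (by omega), Finset.sum_range_succ' (fun l => max _ _),
    Finset.sum_range_succ (fun l => min _ _), e2]
  ring

lemma sum_lam (i j : ℕ) {L : ℕ} (hL : min i j ≤ L) :
    ∑ l ∈ Finset.range L, lam X i j l =
      ∑ p ∈ Finset.range i, ∑ q ∈ Finset.range j, X p q := by
  have key : ∀ L, min i j < L → ∑ l ∈ Finset.range L, lam X i j l =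
      ∑ p ∈ Finset.range i, ∑ q ∈ Finset.range j, X p q := by
    induction i generalizing j with
    | zero => simp
    | succ i ihi =>
      induction j with
      | zero => simp
      | succ j ihj =>
        intro L hL
        have h := sum_lam_corner hX i j (L := L + 1) (by omega)
        have e := Finset.sum_range_succ (lam X (i + 1) (j + 1)) L
        rw [lam_eq_zero_of_le X _ _ L (by omega)] at e
        rw [ihi (j + 1) (by omega) (L + 1) (by omega), ihi j (by omega) (L + 1) (by omega),
          ihj (by omega) (L + 1) (by omega), e] at h
        rw [Finset.sum_range_succ (fun p => ∑ q ∈ Finset.range j, X p q)] at h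
        rw [Finset.sum_range_succ (fun p => ∑ q ∈ Finset.range (j + 1), X p q),
          Finset.sum_range_succ (fun q => X i q) j]
        linarith
  rw [← key (L + 1) (by omega), Finset.sum_range_succ, lam_eq_zero_of_le X i j L hL, add_zero]

lemma alternating_sum_lam (hs : ∀ i j, X i j = X j i) (n : ℕ) {L : ℕ} (hL : n ≤ L) :
    ∑ l ∈ Finset.range L, (-1) ^ l * lam X n n l = ∑ p ∈ Finset.range n, X p p := by
  have hsw : ∀ i j l, lam X i j l = lam X j i l := fun i j l => by
    conv_lhs => rw [show X = fun i j => X j i from funext₂ hs, lam_swap]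
  have key : ∀ L, n < L → ∑ l ∈ Finset.range L, (-1) ^ l * lam X n n l =
      ∑ p ∈ Finset.range n, X p p := by
    induction n with
    | zero => simp
    | succ n ih =>
      intro L hL
      obtain ⟨L, rfl⟩ : ∃ k, L = k + 1 := ⟨L - 1, by omega⟩
      have e : ∀ l, lam X (n + 1) (n + 1) (l + 1) =
          lam X n (n + 1) (l + 1) + lam X n (n + 1) l - lam X n n l := fun l => by
        rw [lam_succ_succ_of_nonneg hX, hsw (n + 1) n, hsw (n + 1) n, max_self, min_self]
      have h2 : ∑ l ∈ Finset.range (L + 1), (-1) ^ l * lam X n (n + 1) l =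
        ∑ l ∈ Finset.range L, (-1) ^ l * lam X n (n + 1) l := by
        rw [Finset.sum_range_succ, lam_eq_zero_of_le X _ _ L (by omega), mul_zero, add_zero]
      rw [Finset.sum_range_succ'] at h2
      rw [Finset.sum_range_succ', Finset.sum_range_succ _ n, ← ih (by omega) L (by omega),
        lam_succ_zero, hsw (n + 1) n, max_self]
      have h3 : ∑ l ∈ Finset.range L, (-1 : ℝ) ^ (l + 1) * lam X (n + 1) (n + 1) (l + 1) =
          ∑ l ∈ Finset.range L, (-1 : ℝ) ^ (l + 1) * lam X n (n + 1) (l + 1)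
          - ∑ l ∈ Finset.range L, (-1 : ℝ) ^ l * lam X n (n + 1) l
          + ∑ l ∈ Finset.range L, (-1 : ℝ) ^ l * lam X n n l := by
        rw [← Finset.sum_sub_distrib, ← Finset.sum_add_distrib]
        refine Finset.sum_congr rfl fun l _ => ?_
        rw [e, pow_succ]
        ring
      simp only [pow_zero, one_mul] at h2 ⊢
      linarith
  rw [← key (L + 1) (by omega), Finset.sum_range_succ, lam_eq_zero_of_le X n n L (by simpa),
    mul_zero, add_zero]

end Nonneg

/-! ### Displacements and shapes -/

/-- The array obtained from a matrix by padding with zeros. -/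
def zeroPad {m n : ℕ} (X : Fin m → Fin n → ℝ) (i j : ℕ) : ℝ :=
  if h : i < m ∧ j < n then X ⟨i, h.1⟩ ⟨j, h.2⟩ else 0

lemma zeroPad_nonneg {m n : ℕ} {X : Fin m → Fin n → ℝ} (hX : ∀ i j, 0 ≤ X i j) (i j : ℕ) :
    0 ≤ zeroPad X i j := by
  unfold zeroPad; split_ifs
  · exact hX _ _
  · exact le_rfl

lemma zeroPad_coe {m n : ℕ} (X : Fin m → Fin n → ℝ) (i : Fin m) (j : Fin n) :
    zeroPad X i j = X i j := by
  simp [zeroPad]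

lemma nucleation_eq {m n : ℕ} (X : Fin m → Fin n → ℝ) (i j : ℕ) :
    nucleation X (i + j + 1) ((j : ℤ) - i) = zeroPad X i j := by
  have h : ∀ (a : Fin m) (b : Fin n), ((a : ℕ) + (b : ℕ) + 1 = i + j + 1 ∧
      ((b : ℕ) : ℤ) - ((a : ℕ) : ℤ) = (j : ℤ) - i) ↔ ((a : ℕ) = i ∧ (b : ℕ) = j) := by
    intro a b; omega
  unfold nucleation zeroPad
  simp only [h]
  split_ifs with hij
  · rw [Finset.sum_eq_single ⟨i, hij.1⟩, Finset.sum_eq_single ⟨j, hij.2⟩]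
    · simp
    · intro b _ hb
      rw [if_neg]
      rintro ⟨_, rfl⟩
      exact hb rfl
    · simp
    · intro a _ ha
      refine Finset.sum_eq_zero fun b _ => ?_
      rw [if_neg]
      rintro ⟨rfl, _⟩
      exact ha rfl
    · simp
  · refine Finset.sum_eq_zero fun a _ => Finset.sum_eq_zero fun b _ => ?_
    rw [if_neg]
    rintro ⟨rfl, rfl⟩
    exact hij ⟨a.2, b.2⟩

lemma nucleation_eq_zero {m n : ℕ} (X : Fin m → Fin n → ℝ) (t : ℕ) (x : ℤ)
    (h : ∀ i j : ℕ, i + j + 1 = t → (j : ℤ) - i ≠ x) : nucleation X t x = 0 := by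
  refine Finset.sum_eq_zero fun a _ => Finset.sum_eq_zero fun b _ => ?_
  rw [if_neg]
  rintro ⟨h1, h2⟩
  exact h a b h1 h2

lemma profile_eq_lam {m n : ℕ} {X : Fin m → Fin n → ℝ} (hX : ∀ i j, 0 ≤ X i j) (t : ℕ) :
    ∀ (l : ℕ) (i j : ℤ), i + j = t ∨ i + j = t + 1 →
      profile X t l (j - i) = lam (zeroPad X) i.toNat j.toNat l := by
  have hP := zeroPad_nonneg hX
  have hz : ∀ (i j : ℤ) l, i ≤ 0 ∨ j ≤ 0 → lam (zeroPad X) i.toNat j.toNat l = 0 := by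
    rintro i j l (h | h)
    · rw [Int.toNat_of_nonpos h, lam_zero_left]
    · rw [Int.toNat_of_nonpos h, lam_zero_right]
  induction t with
  | zero =>
    intro l i j h
    rw [hz i j l (by omega)]
    simp [profile]
  | succ t ih =>
    have hL : ∀ (i j : ℤ) l, lam (zeroPad X) (i - 1).toNat j.toNat l ≤
        lam (zeroPad X) i.toNat j.toNat l := fun i j l =>
      lam_mono hP (by omega) le_rfl l
    have hR : ∀ (i j : ℤ) l, lam (zeroPad X) i.toNat (j - 1).toNat l ≤
        lam (zeroPad X) i.toNat j.toNat l := fun i j l =>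
      lam_mono hP le_rfl (by omega) l
    intro l i j h
    rcases h with h | h
    · have e0 : ∀ l, profile X t l (j - i) = lam (zeroPad X) i.toNat j.toNat l := fun l =>
        ih l i j (by omega)
      have e1 : ∀ l, profile X t l (j - i - 1) = lam (zeroPad X) i.toNat (j - 1).toNat l :=
        fun l => by rw [← ih l i (j - 1) (by omega)]; congr 1; ring
      have e2 : ∀ l, profile X t l (j - i + 1) = lam (zeroPad X) (i - 1).toNat j.toNat l :=
        fun l => by rw [← ih l (i - 1) j (by omega)]; congr 1; ring
      have hg : ∀ l, grow (profile X t l) (j - i) = lam (zeroPad X) i.toNat j.toNat l := by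
        intro l
        rw [grow, e0, e1, e2]
        exact max_eq_left (max_le (hR i j l) (hL i j l))
      rcases l with _ | l
      · rw [profile, hg, nucleation_eq_zero, add_zero]
        intro a b hab
        push_cast at h; omega
      · rw [profile, hg, overlap, e0, e1, e2, max_eq_left, add_zero]
        have := min_le_left (lam (zeroPad X) i.toNat (j - 1).toNat l)
          (lam (zeroPad X) (i - 1).toNat j.toNat l)
        linarith [hR i j l]
    · have e0 : ∀ l, profile X t l (j - i) =
          lam (zeroPad X) (i - 1).toNat (j - 1).toNat l := fun l => by
        rw [← ih l (i - 1) (j - 1) (by push_cast at h; omega)]; congr 1; ring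
      have e1 : ∀ l, profile X t l (j - i - 1) = lam (zeroPad X) i.toNat (j - 1).toNat l :=
        fun l => by rw [← ih l i (j - 1) (by push_cast at h; omega)]; congr 1; ring
      have e2 : ∀ l, profile X t l (j - i + 1) = lam (zeroPad X) (i - 1).toNat j.toNat l :=
        fun l => by rw [← ih l (i - 1) j (by push_cast at h; omega)]; congr 1; ring
      have hg : ∀ l, grow (profile X t l) (j - i) = max (lam (zeroPad X) (i - 1).toNat j.toNat l)
          (lam (zeroPad X) i.toNat (j - 1).toNat l) := by
        intro l
        rw [grow, e0, e1, e2, max_eq_right, max_comm]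
        exact (hR (i - 1) j l).trans (le_max_right _ _)
      by_cases hij : i ≤ 0 ∨ j ≤ 0
      · have z1 : ∀ l, lam (zeroPad X) (i - 1).toNat j.toNat l = 0 := fun l => hz _ _ l (by omega)
        have z2 : ∀ l, lam (zeroPad X) i.toNat (j - 1).toNat l = 0 := fun l => hz _ _ l (by omega)
        have z3 : ∀ l, lam (zeroPad X) (i - 1).toNat (j - 1).toNat l = 0 :=
          fun l => hz _ _ l (by omega)
        rw [hz _ _ _ hij]
        rcases l with _ | l
        · rw [profile, hg, z1, z2, nucleation_eq_zero]
          · simp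
          · intro a b hab
            push_cast at h; omega
        · rw [profile, hg, overlap, e0, e1, e2, z1, z2, z1, z2, z3]
          simp
      · obtain ⟨i, rfl⟩ : ∃ k : ℕ, i = k + 1 := ⟨(i - 1).toNat, by omega⟩
        obtain ⟨j, rfl⟩ : ∃ k : ℕ, j = k + 1 := ⟨(j - 1).toNat, by omega⟩
        have c1 : ((i : ℤ) + 1 - 1).toNat = i := by omega
        have c2 : ((j : ℤ) + 1 - 1).toNat = j := by omega
        have c3 : ((i : ℤ) + 1).toNat = i + 1 := by omega
        have c4 : ((j : ℤ) + 1).toNat = j + 1 := by omega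
        simp only [c1, c2, c3, c4] at e0 e1 e2 hg ⊢
        rcases l with _ | l
        · rw [profile, hg, lam_succ_zero]
          congr 1
          rw [← nucleation_eq]
          congr 1
          · push_cast at h; omega
          · ring
        · rw [profile, hg, overlap, e0, e1, e2, lam_succ_succ_of_nonneg hP,
            max_eq_right (a := (0 : ℝ)), min_comm, add_sub_assoc]
          rw [sub_nonneg, min_comm]
          exact le_min (lam_prec_right hP i j l).2 (lam_prec_left hP i j l).2

theorem displacement_eq_lam {m n : ℕ} {X : Fin m → Fin n → ℝ} (hX : ∀ i j, 0 ≤ X i j) (l : ℕ) :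
    displacement X l = lam (zeroPad X) m n l := by
  have hP := zeroPad_nonneg hX
  have s1 : ∀ i ≥ m, ∀ j, zeroPad X i j = 0 := fun i hi j => by
    rw [zeroPad, dif_neg (by omega)]
  have s2 : ∀ i, ∀ j ≥ n, zeroPad X i j = 0 := fun i j hj => by
    rw [zeroPad, dif_neg (by omega)]
  have hle : ∀ x, profile X (2 * max m n - 1) l x ≤ lam (zeroPad X) m n l := by
    intro x
    obtain ⟨i, j, hij, rfl⟩ : ∃ i j : ℤ, (i + j = (2 * max m n - 1 : ℕ) ∨
        i + j = (2 * max m n - 1 : ℕ) + 1) ∧ j - i = x := by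
      generalize 2 * max m n - 1 = t
      rcases Int.even_or_odd ((t : ℤ) - x) with ⟨k, hk⟩ | ⟨k, hk⟩
      · exact ⟨k, k + x, by omega, by omega⟩
      · exact ⟨k + 1, k + 1 + x, by omega, by omega⟩
    rw [profile_eq_lam hX _ l i j hij]
    exact lam_le_of_support hP m n _ _ s1 s2 l
  have h0 : profile X (2 * max m n - 1) l 0 = lam (zeroPad X) m n l := by
    rcases Nat.eq_zero_or_pos (max m n) with h | h
    · rw [h]
      obtain rfl : m = 0 := by omega
      simp [profile]
    · rw [← lam_add_rows hP m (max m n) n s1 (le_max_left _ _),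
        ← lam_add_columns hP (max m n) n (max m n) s2 (le_max_right _ _)]
      have := profile_eq_lam hX (2 * max m n - 1) l (max m n : ℕ) (max m n : ℕ) (by omega)
      rwa [Int.toNat_natCast, sub_self] at this
  exact le_antisymm (ciSup_le hle) (h0.ge.trans (le_ciSup ⟨_, by rintro _ ⟨x, rfl⟩; exact hle x⟩ 0))

/-! ### The correspondence as a volume preserving map -/

lemma measurePreserving_reflect {ι : Type*} [Fintype ι] (E : ι → Prop) [DecidablePred E]
    (ε : ι → ℝ) (hε : ∀ i, ε i = 1 ∨ ε i = -1) (g : (ι → ℝ) → ι → ℝ)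
    (hg : ∀ i, Measurable fun t => g t i)
    (hdep : ∀ t t', (∀ p, E p → t p = t' p) → g t = g t') :
    MeasurePreserving (fun (t : ι → ℝ) p => if E p then t p else ε p * t p + g t p)
      volume volume := by
  let e := MeasurableEquiv.piEquivPiSubtypeProd (fun _ : ι => ℝ) E
  have he : MeasurePreserving e volume volume :=
    volume_preserving_piEquivPiSubtypeProd (fun _ : ι => ℝ) E
  let G : ({i // E i} → ℝ) → ({i // ¬ E i} → ℝ) → ({i // ¬ E i} → ℝ) := fun a c i =>
    ε i * c i + g (e.symm (a, 0)) i
  have hG : MeasurePreserving (fun p : ({i // E i} → ℝ) × ({i // ¬ E i} → ℝ) => (p.1, G p.1 p.2))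
      (volume.prod volume) (volume.prod volume) := by
    refine (MeasurePreserving.id _).skew_product ?_ (Filter.Eventually.of_forall fun a => ?_)
    · refine measurable_pi_lambda _ fun i => ?_
      refine Measurable.add ?_ ?_
      · exact measurable_const.mul ((measurable_pi_apply i).comp measurable_snd)
      · exact (hg i).comp (e.symm.measurable.comp (measurable_fst.prodMk measurable_const))
    · refine (volume_preserving_pi (f := fun (i : {i // ¬ E i}) (x : ℝ) =>
        ε i * x + g (e.symm (a, 0)) i) fun i => ?_).map_eq
      rcases hε i with h | h
      · simp only [h, one_mul]
        exact measurePreserving_add_right volume _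
      · simp only [h, neg_mul, one_mul]
        exact (measurePreserving_add_right volume _).comp (Measure.measurePreserving_neg volume)
  have := (he.symm.comp hG).comp he
  convert this using 1
  funext t p
  have h1 : g (e.symm ((e t).1, 0)) = g t := by
    apply hdep
    intro p hp
    simp [e, MeasurableEquiv.piEquivPiSubtypeProd, Equiv.piEquivPiSubtypeProd, hp]
  by_cases hp : E p
  · simp [e, MeasurableEquiv.piEquivPiSubtypeProd, Equiv.piEquivPiSubtypeProd, hp]
  · simp only [Function.comp, G, h1]
    simp [e, MeasurableEquiv.piEquivPiSubtypeProd, Equiv.piEquivPiSubtypeProd, hp]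

/-- The array in which the sites `(i, j)` with `i + j < s` have been processed: along each diagonal
it shows the shape at the last processed site of the diagonal in the `m × n` rectangle. -/
def stage (m n : ℕ) (X : ℕ → ℕ → ℝ) (s i j : ℕ) : ℝ :=
  if s ≤ i + j then X i j else
    lam X (i + min ((s - 1 - i - j) / 2) (min (m - 1 - i) (n - 1 - j)) + 1)
      (j + min ((s - 1 - i - j) / 2) (min (m - 1 - i) (n - 1 - j)) + 1)
      (min ((s - 1 - i - j) / 2) (min (m - 1 - i) (n - 1 - j)))

lemma stage_eq_lam {m n : ℕ} (X : ℕ → ℕ → ℝ) {s i j k : ℕ} (h : i + j < s)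
    (hk : min ((s - 1 - i - j) / 2) (min (m - 1 - i) (n - 1 - j)) = k) :
    stage m n X s i j = lam X (i + k + 1) (j + k + 1) k := by
  rw [stage, if_neg (by omega), hk]

/-- The sites which are not touched in the step `s`. -/
def Untouched (m n s i j : ℕ) : Prop :=
  ¬ (i + j ≤ s ∧ (s - i - j) % 2 = 0 ∧ (s - i - j) / 2 ≤ min (m - 1 - i) (n - 1 - j))

instance (m n s i j : ℕ) : Decidable (Untouched m n s i j) := by
  unfold Untouched; infer_instance

/-- The increment in the step `s` at a touched site. -/
def increment (s : ℕ) (T : ℕ → ℕ → ℝ) (i j : ℕ) : ℝ :=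
  max (if i = 0 then 0 else T (i - 1) j) (if j = 0 then 0 else T i (j - 1)) +
    if i + j = s then 0 else min (T i (j + 1)) (T (i + 1) j)

lemma stage_zero (m n : ℕ) (X : ℕ → ℕ → ℝ) (i j : ℕ) : stage m n X 0 i j = X i j := by
  simp [stage]

lemma stage_succ_of_untouched {m n : ℕ} (X : ℕ → ℕ → ℝ) {s i j : ℕ}
    (h : Untouched m n s i j) : stage m n X (s + 1) i j = stage m n X s i j := by
  unfold Untouched at h
  rcases lt_or_ge s (i + j) with hs | hs
  · rw [stage, stage, if_pos (by omega), if_pos (by omega)]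
  · have : i + j ≠ s := by
      rintro rfl
      apply h
      simp
    rw [stage_eq_lam X (by omega) rfl, stage_eq_lam X (k := min ((s + 1 - 1 - i - j) / 2)
      (min (m - 1 - i) (n - 1 - j))) (by omega) (by omega)]

lemma stage_succ_of_touched {m n : ℕ} (X : ℕ → ℕ → ℝ) {s i j : ℕ}
    (h : ¬ Untouched m n s i j) : stage m n X (s + 1) i j =
      (if i + j = s then 1 else -1) * stage m n X s i j + increment s (stage m n X s) i j := by
  unfold Untouched at h
  rw [not_not] at h
  obtain ⟨h1, h2, h3⟩ := h
  rcases eq_or_lt_of_le h1 with rfl | hlt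
  · rw [stage_eq_lam X (k := 0) (by omega) (by omega), lam_succ_zero, increment, if_pos rfl,
      if_pos rfl, one_mul, add_zero, add_comm]
    congr 1
    · rw [stage, if_pos le_rfl]
    · congr 1
      · rcases i with _ | i
        · simp
        · rw [if_neg (by omega), stage_eq_lam X (k := 0) (by omega) (by omega)]; rfl
      · rcases j with _ | j
        · simp
        · rw [if_neg (by omega), stage_eq_lam X (k := 0) (by omega) (by omega)]; rfl
  · obtain ⟨k, rfl⟩ : ∃ k, s = i + j + 2 * (k + 1) := ⟨(s - i - j) / 2 - 1, by omega⟩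
    rw [stage_eq_lam X (k := k + 1) (by omega) (by omega), increment,
      if_neg (show ¬ i + j = i + j + 2 * (k + 1) by omega),
      if_neg (show ¬ i + j = i + j + 2 * (k + 1) by omega), stage_eq_lam X (j := j) (i := i) (k := k) (by omega) (by omega),
      stage_eq_lam X (j := j + 1) (i := i) (k := k) (by omega) (by omega),
      stage_eq_lam X (j := j) (i := i + 1) (k := k) (by omega) (by omega),
      show i + (k + 1) + 1 = (i + k + 1) + 1 by ring, show j + (k + 1) + 1 = (j + k + 1) + 1 by ring,
      lam_succ_succ X (by omega)]
    have e1 : (if i = 0 then 0 else stage m n X (i + j + 2 * (k + 1)) (i - 1) j) =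
        lam X (i + k + 1) (j + k + 1 + 1) (k + 1) := by
      rcases i with _ | i
      · rw [if_pos rfl, lam_eq_zero_of_le]
        omega
      · rw [if_neg (by omega), stage_eq_lam X (k := k + 1) (by omega) (by omega)]
        congr 1; omega
    have e2 : (if j = 0 then 0 else stage m n X (i + j + 2 * (k + 1)) i (j - 1)) =
        lam X (i + k + 1 + 1) (j + k + 1) (k + 1) := by
      rcases j with _ | j
      · rw [if_pos rfl, lam_eq_zero_of_le]
        omega
      · rw [if_neg (by omega), stage_eq_lam X (k := k + 1) (by omega) (by omega)]
        congr 1; omega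
    rw [e1, e2, show j + 1 + k + 1 = j + k + 1 + 1 by ring, show i + 1 + k + 1 = i + k + 1 + 1 by ring]
    ring

lemma stage_swap (m n : ℕ) (X : ℕ → ℕ → ℝ) (s i j : ℕ) :
    stage m n (fun i j => X j i) s i j = stage n m X s j i := by
  unfold stage
  rw [lam_swap, add_comm j i, min_comm (m - 1 - i), show s - 1 - j - i = s - 1 - i - j by omega]

lemma stage_final {m n : ℕ} (X : ℕ → ℕ → ℝ) {i j k : ℕ} (hi : i < m) (hj : j < n)
    (hk : min (m - 1 - i) (n - 1 - j) = k) :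
    stage m n X (m + n) i j = lam X (i + k + 1) (j + k + 1) k :=
  stage_eq_lam X (by omega) (by omega)

/-- A finite system of coordinates for arrays on an `m × n` rectangle: each of the coordinates `p`
is the entry at the site `(row p, col p)`, and `emb t` is the array with the coordinates `t`. -/
structure Chart (ι : Type*) (m n : ℕ) where
  row : ι → ℕ
  col : ι → ℕ
  emb : (ι → ℝ) → ℕ → ℕ → ℝ
  row_lt : ∀ p, row p < m
  col_lt : ∀ p, col p < n
  emb_self : ∀ t p, emb t (row p) (col p) = t p
  emb_congr : ∀ i j t t', (∀ p, row p + col p = i + j → t p = t' p) → emb t i j = emb t' i j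
  measurable_emb : ∀ i j, Measurable fun t => emb t i j
  emb_stage : ∀ t s i j, i < m → j < n →
    emb (fun p => stage m n (emb t) s (row p) (col p)) i j = stage m n (emb t) s i j

namespace Chart

variable {ι : Type*} {m n : ℕ} (c : Chart ι m n)

/-- The coordinates of the array at stage `s`. -/
def flow (s : ℕ) (t : ι → ℝ) (p : ι) : ℝ := stage m n (c.emb t) s (c.row p) (c.col p)

lemma emb_flow (s : ℕ) (t : ι → ℝ) {i j : ℕ} (hi : i < m) (hj : j < n) :
    c.emb (c.flow s t) i j = stage m n (c.emb t) s i j := c.emb_stage t s i j hi hj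

lemma increment_emb_congr {t t' : ι → ℝ} {s i j : ℕ} (h : (s - i - j) % 2 = 0) (hs : i + j ≤ s)
    (ht : ∀ p, c.row p + c.col p < s → (s - c.row p - c.col p) % 2 = 1 → t p = t' p) :
    increment s (c.emb t) i j = increment s (c.emb t') i j := by
  have key : ∀ a b, a + b < s → (s - a - b) % 2 = 1 → c.emb t a b = c.emb t' a b :=
    fun a b h1 h2 => c.emb_congr a b t t' fun p hp => ht p (by omega) (by omega)
  unfold increment
  congr 1
  · congr 1
    · split_ifs
      · rfl
      · exact key _ _ (by omega) (by omega)
    · split_ifs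
      · rfl
      · exact key _ _ (by omega) (by omega)
  · split_ifs
    · rfl
    · congr 1 <;> exact key _ _ (by omega) (by omega)

theorem measurePreserving_flow [Fintype ι] (s : ℕ) :
    MeasurePreserving (c.flow s) volume volume := by
  induction s with
  | zero =>
    have : c.flow 0 = id := by
      funext t p
      simp [flow, stage_zero, c.emb_self]
    rw [this]
    exact MeasurePreserving.id _
  | succ s ih =>
    have h := (measurePreserving_reflect
      (fun p => Untouched m n s (c.row p) (c.col p))
      (fun p => if c.row p + c.col p = s then 1 else -1)
      (fun p => by split_ifs <;> simp)
      (fun t p => if Untouched m n s (c.row p) (c.col p) then 0 else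
        increment s (c.emb t) (c.row p) (c.col p)) ?_ ?_).comp ih
    · convert h using 1
      funext t p
      simp only [Function.comp]
      by_cases hp : Untouched m n s (c.row p) (c.col p)
      · rw [if_pos hp, flow, stage_succ_of_untouched _ hp, flow]
      · rw [if_neg hp, if_neg hp, flow, stage_succ_of_touched _ hp, flow]
        congr 1
        have hp' := hp
        unfold Untouched at hp'
        rw [not_not] at hp'
        have h1 := c.row_lt p
        have h2 := c.col_lt p
        unfold increment
        congr 1
        · congr 1
          · split_ifs
            · rfl
            · rw [c.emb_flow _ _ (by omega) (by omega)]
          · split_ifs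
            · rfl
            · rw [c.emb_flow _ _ (by omega) (by omega)]
        · split_ifs
          · rfl
          · rw [c.emb_flow _ _ (by omega) (by omega), c.emb_flow _ _ (by omega) (by omega)]
    · intro p
      split_ifs
      · exact measurable_const
      · unfold increment
        refine Measurable.add (Measurable.max ?_ ?_) ?_
        · split_ifs
          · exact measurable_const
          · exact c.measurable_emb _ _
        · split_ifs
          · exact measurable_const
          · exact c.measurable_emb _ _
        · split_ifs
          · exact measurable_const
          · exact (c.measurable_emb _ _).min (c.measurable_emb _ _)
    · intro t t' ht
      funext p
      split_ifs with hp
      · rfl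
      · unfold Untouched at hp
        rw [not_not] at hp
        refine c.increment_emb_congr hp.2.1 hp.1 fun q _ h2 => ht q ?_
        unfold Untouched
        omega

end Chart

/-- The entries of an `m × n` matrix as coordinates. -/
def rectChart (m n : ℕ) : Chart (Fin m × Fin n) m n where
  row p := p.1
  col p := p.2
  emb t := zeroPad fun i j => t (i, j)
  row_lt p := p.1.2
  col_lt p := p.2.2
  emb_self t p := zeroPad_coe _ p.1 p.2
  emb_congr i j t t' h := by
    unfold zeroPad
    split_ifs
    · exact h _ rfl
    · rfl
  measurable_emb i j := by
    unfold zeroPad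
    split_ifs
    · exact measurable_pi_apply _
    · exact measurable_const
  emb_stage t s i j hi hj := by
    rw [zeroPad, dif_pos ⟨hi, hj⟩]

/-- The symmetric matrix with given entries on and above the diagonal. -/
def symmMatrix {n : ℕ} (t : {p : Fin n × Fin n // p.1 ≤ p.2} → ℝ) (i j : Fin n) : ℝ :=
  t ⟨(min i j, max i j), min_le_max⟩

lemma symmMatrix_comm {n : ℕ} (t : {p : Fin n × Fin n // p.1 ≤ p.2} → ℝ) (i j : Fin n) :
    symmMatrix t i j = symmMatrix t j i := by
  unfold symmMatrix; simp only [min_comm, max_comm]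

lemma zeroPad_symm {n : ℕ} {X : Fin n → Fin n → ℝ} (h : ∀ i j, X i j = X j i) (i j : ℕ) :
    zeroPad X i j = zeroPad X j i := by
  unfold zeroPad
  by_cases hij : i < n ∧ j < n
  · rw [dif_pos hij, dif_pos hij.symm, h]
  · rw [dif_neg hij, dif_neg fun h => hij h.symm]

/-- The entries on and above the diagonal of a symmetric `n × n` matrix as coordinates. -/
def symmChart (n : ℕ) : Chart {p : Fin n × Fin n // p.1 ≤ p.2} n n where
  row p := p.1.1
  col p := p.1.2
  emb t := zeroPad (symmMatrix t)
  row_lt p := p.1.1.2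
  col_lt p := p.1.2.2
  emb_self t p := by
    rw [zeroPad_coe, symmMatrix]
    congr 2
    exact Prod.ext (min_eq_left p.2) (max_eq_right p.2)
  emb_congr i j t t' h := by
    unfold zeroPad
    split_ifs
    · refine h _ ?_
      rcases le_total i j with hij | hij <;> simp [hij, add_comm]
    · rfl
  measurable_emb i j := by
    unfold zeroPad
    split_ifs
    · exact measurable_pi_apply _
    · exact measurable_const
  emb_stage t s i j hi hj := by
    rw [zeroPad, dif_pos ⟨hi, hj⟩, symmMatrix]
    rcases le_total i j with hij | hij
    · simp [hij]
    · simp only [Fin.mk_le_mk, hij, inf_of_le_right, sup_of_le_left]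
      rw [← stage_swap]
      congr 1
      funext a b
      exact zeroPad_symm (symmMatrix_comm t) b a

/-! ### Volumes of Gelfand-Tsetlin patterns -/

lemma integral_det_eq {k : ℕ} (ν : Fin k → Measure ℝ) [∀ i, IsFiniteMeasure (ν i)]
    (g : Fin k → ℝ → ℝ) (hg : ∀ i j, Integrable (g j) (ν i)) :
    ∫ x : Fin k → ℝ, (Matrix.of fun i j => g j (x i)).det ∂(Measure.pi ν) =
      (Matrix.of fun i j => ∫ x, g j x ∂(ν i)).det := by
  have h : ∀ M : Matrix (Fin k) (Fin k) ℝ,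
      M.det = ∑ σ : Equiv.Perm (Fin k), (Equiv.Perm.sign σ : ℝ) * ∏ i, M i (σ i) := fun M => by
    rw [← Matrix.det_transpose, Matrix.det_apply']; rfl
  simp only [h, Matrix.of_apply]
  rw [integral_finsetSum]
  · refine Finset.sum_congr rfl fun σ _ => ?_
    rw [integral_const_mul, integral_fintype_prod_eq_prod (fun i x => g (σ i) x)]
  · intro σ _
    exact (Integrable.fintype_prod (f := fun i x => g (σ i) x) fun i => hg i (σ i)).const_mul _

lemma diffProd_eq_det {k : ℕ} (x : Fin k → ℝ) (w : ℝ) :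
    diffProd x = (Matrix.vandermonde fun i => w - x i).det := by
  rw [Matrix.det_vandermonde, diffProd]
  refine Finset.prod_congr rfl fun i _ => Finset.prod_congr rfl fun j _ => ?_
  ring

lemma det_sub_next {k : ℕ} (D : Fin (k + 1) → Fin k → ℝ) (h0 : ∀ j, D (Fin.last k) j = 0) :
    (Matrix.of fun (i j : Fin k) => D i.castSucc j - D i.succ j).det =
      (Matrix.of fun (i j : Fin k) => D i.castSucc j).det := by
  rcases k with _ | k
  · simp
  rw [← Matrix.det_submatrix_equiv_self Fin.revPerm,
    ← Matrix.det_submatrix_equiv_self Fin.revPerm (Matrix.of fun i j => D i.castSucc j)]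
  symm
  refine Matrix.det_eq_of_forall_row_eq_smul_add_pred (fun _ => 1) (fun j => ?_) (fun i j => ?_)
  · simp [Fin.rev_zero, h0]
  · simp only [Matrix.submatrix_apply, Fin.revPerm_apply, Matrix.of_apply, one_mul]
    have : (Fin.rev i.succ).succ = (Fin.rev i.castSucc).castSucc := by
      ext; simp [Fin.val_rev]; omega
    rw [this]; ring

lemma prod_inv_eq (p k : ℕ) :
    ∏ j : Fin k, ((p + j + 1 : ℕ) : ℝ)⁻¹ = (p.factorial : ℝ) / ((p + k).factorial : ℝ) := by
  induction k with
  | zero => simp [div_self, Nat.factorial_ne_zero]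
  | succ k ih =>
    rw [Fin.prod_univ_castSucc]
    simp only [Fin.val_castSucc, Fin.val_last]
    rw [ih, ← add_assoc, Nat.factorial_succ]
    have := Nat.factorial_ne_zero (p + k)
    push_cast
    field_simp

lemma integral_Icc_pow (a b w : ℝ) (hab : a ≤ b) (p j : ℕ) :
    ∫ x in Set.Icc a b, (x - w) ^ p * (w - x) ^ j =
      ((p + j + 1 : ℕ) : ℝ)⁻¹ * ((b - w) ^ (p + 1) * (w - b) ^ j - (a - w) ^ (p + 1) * (w - a) ^ j) := by
  have e : ∀ x : ℝ, (x - w) ^ p * (w - x) ^ j = (-1) ^ j * (x - w) ^ (p + j) := fun x => by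
    rw [← neg_sub x w, neg_pow, pow_add]; ring
  have e' : ∀ x : ℝ, (x - w) ^ (p + 1) * (w - x) ^ j = (-1) ^ j * (x - w) ^ (p + j + 1) :=
    fun x => by rw [← neg_sub x w, neg_pow, add_right_comm, pow_add (x - w) (p + 1)]; ring
  simp only [e, e']
  rw [integral_Icc_eq_integral_Ioc, ← intervalIntegral.integral_of_le hab,
    intervalIntegral.integral_const_mul,
    intervalIntegral.integral_comp_sub_right (fun x => x ^ (p + j)), integral_pow]
  push_cast
  field_simp

/-- The integral of a Vandermonde product over the sequences which interlace with `v`. -/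
theorem integral_interlacing {k : ℕ} (p : ℕ) (w : ℝ) (v : Fin (k + 1) → ℝ) (hv : Antitone v)
    (hw : v (Fin.last k) = w) :
    ∫ x in Set.pi Set.univ (fun i : Fin k => Set.Icc (v i.succ) (v i.castSucc)),
        (∏ i, (x i - w) ^ p) * diffProd x =
      (p.factorial : ℝ) / ((p + k).factorial : ℝ) *
        ((∏ i : Fin k, (v i.castSucc - w) ^ (p + 1)) * diffProd fun i : Fin k => v i.castSucc) := by
  have e1 : ∀ x : Fin k → ℝ, (∏ i, (x i - w) ^ p) * diffProd x =
      (Matrix.of fun i (j : Fin k) => (x i - w) ^ p * (w - x i) ^ (j : ℕ)).det := fun x => by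
    rw [diffProd_eq_det x w, ← Matrix.det_mul_column]; rfl
  simp only [e1]
  rw [volume_pi, Measure.restrict_pi_pi,
    integral_det_eq _ (fun (j : Fin k) x => (x - w) ^ p * (w - x) ^ (j : ℕ))]
  · have e2 : (Matrix.of fun (i j : Fin k) => ∫ x in Set.Icc (v i.succ) (v i.castSucc),
          (x - w) ^ p * (w - x) ^ (j : ℕ)) =
        Matrix.of fun (i j : Fin k) => ((p + j + 1 : ℕ) : ℝ)⁻¹ *
          (Matrix.of fun (i j : Fin k) =>
            (v i.castSucc - w) ^ (p + 1) * (w - v i.castSucc) ^ (j : ℕ) -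
            (v i.succ - w) ^ (p + 1) * (w - v i.succ) ^ (j : ℕ)) i j := by
      ext i j
      simp only [Matrix.of_apply]
      exact integral_Icc_pow _ _ _ (hv (Fin.castSucc_lt_succ (i := i)).le) _ _
    rw [e2, Matrix.det_mul_row, prod_inv_eq,
      det_sub_next (fun i j => (v i - w) ^ (p + 1) * (w - v i) ^ (j : ℕ)) (fun j => by simp [hw]),
      diffProd_eq_det _ w, ← Matrix.det_mul_column]
    rfl
  · intro i j
    exact Continuous.integrableOn_Icc (by fun_prop)

/-- The sequence obtained by padding with zeros. -/
def pad {k : ℕ} (v : Fin k → ℝ) (l : ℕ) : ℝ := if h : l < k then v ⟨l, h⟩ else 0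

lemma pad_coe {k : ℕ} (v : Fin k → ℝ) (i : Fin k) : pad v i = v i := by simp [pad]

lemma pad_of_le {k : ℕ} (v : Fin k → ℝ) {l : ℕ} (h : k ≤ l) : pad v l = 0 := by
  simp [pad, not_lt.2 h]

/-- A weakly decreasing sequence of nonnegative numbers. -/
def Dec (u : ℕ → ℝ) : Prop := Antitone u ∧ ∀ l, 0 ≤ u l

/-- The volume of the set of chains `u₁ ≺ ⋯ ≺ u_r = u` in which `u_q` has `min q K` terms. -/
def gtVol (r K : ℕ) (u : ℕ → ℝ) : ℝ :=
  superfact (r - K - 1) / superfact (r - 1) *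
    ((∏ i : Fin (min r K), u i ^ (r - K)) * diffProd fun i : Fin (min r K) => u i)

open Classical in
/-- The density which is `gtVol` on decreasing sequences and `0` elsewhere. -/
def gtDens (r K : ℕ) (u : ℕ → ℝ) : ENNReal := if Dec u then ENNReal.ofReal (gtVol r K u) else 0

open Classical in
/-- The indicator function of the interlacing relation. -/
def precInd (u v : ℕ → ℝ) : ENNReal := if Prec u v then 1 else 0

lemma superfact_pos (n : ℕ) : 0 < superfact n :=
  Finset.prod_pos fun _ _ => by positivity

lemma superfact_pred (n : ℕ) : superfact n = superfact (n - 1) * n.factorial := by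
  rcases n with _ | n
  · simp [superfact]
  · rw [superfact, Finset.prod_Icc_succ_top (by omega)]; rfl

lemma diffProd_nonneg {k : ℕ} {x : Fin k → ℝ} (hx : Antitone x) : 0 ≤ diffProd x :=
  Finset.prod_nonneg fun _ _ => Finset.prod_nonneg fun _ hj =>
    sub_nonneg.2 (hx (Finset.mem_Ioi.1 hj).le)

lemma diffProd_castSucc {k : ℕ} (x : Fin (k + 1) → ℝ) :
    diffProd x = (∏ i : Fin k, (x i.castSucc - x (Fin.last k))) *
      diffProd fun i : Fin k => x i.castSucc := by
  unfold diffProd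
  rw [Fin.prod_univ_castSucc]
  have h1 : (Finset.Ioi (Fin.last k)) = ∅ := by ext i; simp [Fin.le_last]
  rw [h1, Finset.prod_empty, mul_one, ← Finset.prod_mul_distrib]
  refine Finset.prod_congr rfl fun i _ => ?_
  have h2 : (Finset.Ioi i.castSucc) =
      insert (Fin.last k) ((Finset.Ioi i).map Fin.castSuccEmb) := by
    ext j
    induction j using Fin.lastCases with
    | last => simp [Fin.castSucc_lt_last]
    | cast j => simpa using fun _ => (Fin.le_last _)
  rw [h2, Finset.prod_insert (by simp), Finset.prod_map]
  rfl

lemma gtVol_nonneg (r K : ℕ) {u : ℕ → ℝ} (hu : Dec u) : 0 ≤ gtVol r K u := by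
  have h1 := superfact_pos (r - K - 1)
  have h2 := superfact_pos (r - 1)
  refine mul_nonneg (by positivity) (mul_nonneg ?_ (diffProd_nonneg fun i j h => hu.1 h))
  exact Finset.prod_nonneg fun i _ => pow_nonneg (hu.2 _) _

lemma Prec.dec {u v : ℕ → ℝ} (h : Prec u v) {k : ℕ} (hk : ∀ l ≥ k, v l = 0) :
    Dec u ∧ Dec v := by
  have av : Antitone v := antitone_nat_of_succ_le fun l => (h l).1.trans (h l).2
  have nv : ∀ l, 0 ≤ v l := fun l => by
    have := av (le_max_left l k)
    rwa [hk _ (le_max_right l k)] at this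
  exact ⟨⟨antitone_nat_of_succ_le fun l => (h (l + 1)).2.trans (h l).1,
    fun l => (nv _).trans (h l).1⟩, av, nv⟩

lemma lintegral_gtDens_of_dec {r K k k' p : ℕ} {u : ℕ → ℝ} (hu : Dec u) (hk : k = min r K)
    (hk' : k' = min (r + 1) K) (hp : p = r - K) (h0 : ∀ l ≥ k', u l = 0) :
    ∫⁻ x : Fin k → ℝ, precInd (pad x) u * gtDens r K (pad x) = ENNReal.ofReal
      (superfact (p - 1) / superfact (r - 1) * ((p.factorial : ℝ) / ((p + k).factorial : ℝ) *
        ((∏ i : Fin k, (u i - u k) ^ (p + 1)) * diffProd fun i : Fin k => u i))) := by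
  have hpk : p ≠ 0 → u k = 0 := fun h => h0 k (by omega)
  let v : Fin (k + 1) → ℝ := fun i => u i
  have hv : Antitone v := fun i j h => hu.1 h
  have box : ∀ x : Fin k → ℝ, Prec (pad x) u ↔
      x ∈ Set.pi Set.univ (fun i : Fin k => Set.Icc (v i.succ) (v i.castSucc)) := by
    intro x
    simp only [Set.mem_univ_pi, Set.mem_Icc]
    constructor
    · intro h i
      have := h i
      rwa [pad_coe] at this
    · intro h l
      rcases lt_or_ge l k with hl | hl
      · have := h ⟨l, hl⟩
        rw [pad, dif_pos hl]
        exact this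
      · rw [pad_of_le x hl, h0 (l + 1) (by omega)]
        exact ⟨le_rfl, hu.2 l⟩
  have hint : ∀ x : Fin k → ℝ, precInd (pad x) u * gtDens r K (pad x) =
      (Set.pi Set.univ (fun i : Fin k => Set.Icc (v i.succ) (v i.castSucc))).indicator
        (fun x => ENNReal.ofReal (superfact (p - 1) / superfact (r - 1) *
          ((∏ i, (x i - u k) ^ p) * diffProd x))) x := by
    intro x
    by_cases hx : Prec (pad x) u
    · rw [Set.indicator_of_mem ((box x).1 hx), precInd, if_pos hx, one_mul, gtDens,
        if_pos (hx.dec h0).1, gtVol, ← hk, ← hp]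
      simp only [pad_coe]
      congr 3
      refine Finset.prod_congr rfl fun i _ => ?_
      by_cases hp0 : p = 0
      · simp [hp0]
      · rw [hpk hp0, sub_zero]
    · rw [Set.indicator_of_notMem fun h => hx ((box x).2 h), precInd, if_neg hx, zero_mul]
  have hm : MeasurableSet
      (Set.pi Set.univ (fun i : Fin k => Set.Icc (v i.succ) (v i.castSucc))) :=
    MeasurableSet.univ_pi fun i => measurableSet_Icc
  have hcont : Continuous fun x : Fin k → ℝ => superfact (p - 1) / superfact (r - 1) *
      ((∏ i, (x i - u k) ^ p) * diffProd x) := by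
    unfold diffProd
    fun_prop
  simp only [hint]
  rw [lintegral_indicator hm, ← ofReal_integral_eq_lintegral_ofReal]
  · rw [integral_const_mul, integral_interlacing p (u k) v hv (by simp [v])]
    rfl
  · refine ContinuousOn.integrableOn_compact ?_ hcont.continuousOn
    exact isCompact_univ_pi fun i => isCompact_Icc
  · refine (ae_restrict_iff' hm).2 (Filter.Eventually.of_forall fun x hx => ?_)
    have hx' := (box x).2 hx
    have hd := (hx'.dec h0).1
    have h1 := superfact_pos (p - 1)
    have h2 := superfact_pos (r - 1)
    refine mul_nonneg (by positivity) (mul_nonneg ?_ (diffProd_nonneg fun i j h => ?_))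
    · refine Finset.prod_nonneg fun i _ => pow_nonneg ?_ _
      have h3 := (hx i (Set.mem_univ i)).1
      have h4 : u k ≤ v i.succ := hu.1 (by simp)
      linarith
    · have := hd.1 (show (i : ℕ) ≤ j from h)
      rwa [pad_coe, pad_coe] at this

/-- Removing the last row of a chain of interlacing sequences. -/
theorem lintegral_gtDens {r K k : ℕ} {u : ℕ → ℝ} (hk : k = min r K)
    (h0 : ∀ l ≥ min (r + 1) K, u l = 0) :
    ∫⁻ x : Fin k → ℝ, precInd (pad x) u * gtDens r K (pad x) = gtDens (r + 1) K u := by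
  by_cases hu : Dec u
  · rw [lintegral_gtDens_of_dec hu hk rfl rfl h0, gtDens, if_pos hu, gtVol]
    congr 1
    subst hk
    rcases lt_or_ge r K with h | h
    · rw [show min r K = r by omega, show min (r + 1) K = r + 1 by omega,
        show r - K = 0 by omega, show r + 1 - K = 0 by omega, diffProd_castSucc,
        show r + 1 - 1 = r by omega, superfact_pred r]
      simp only [Fin.val_castSucc, Fin.val_last, zero_add, pow_one, pow_zero, Finset.prod_const_one,
        one_mul, Nat.factorial_zero, Nat.cast_one]
      have := (superfact_pos (r - 1)).ne'
      have : (r.factorial : ℝ) ≠ 0 := by positivity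
      field_simp
    · rw [show min r K = K by omega, show min (r + 1) K = K by omega, h0 K (by omega),
        show r + 1 - K - 1 = r - K by omega, show r + 1 - 1 = r by omega, superfact_pred r,
        superfact_pred (r - K), show r - K + K = r by omega, show r + 1 - K = r - K + 1 by omega]
      simp only [sub_zero]
      have := (superfact_pos (r - 1)).ne'
      have : (r.factorial : ℝ) ≠ 0 := by positivity
      field_simp
  · rw [gtDens, if_neg hu]
    refine (lintegral_congr fun x => ?_).trans lintegral_zero
    rw [precInd, if_neg fun h => hu (h.dec h0).2, zero_mul]

/-! ### Integrating out chains of interlacing sequences -/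

lemma measurable_precInd {α : Type*} [MeasurableSpace α] {f g : α → ℕ → ℝ}
    (hf : ∀ l, Measurable fun a => f a l) (hg : ∀ l, Measurable fun a => g a l) :
    Measurable fun a => precInd (f a) (g a) := by
  classical
  refine Measurable.ite ?_ measurable_const measurable_const
  have : {a | Prec (f a) (g a)} = ⋂ l, {a | g a (l + 1) ≤ f a l} ∩ {a | f a l ≤ g a l} := by
    ext a; simp [Prec]
  rw [this]
  exact MeasurableSet.iInter fun l => (measurableSet_le (hg _) (hf _)).inter
    (measurableSet_le (hf _) (hg _))

lemma measurable_gtDens {α : Type*} [MeasurableSpace α] (r K : ℕ) {f : α → ℕ → ℝ}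
    (hf : ∀ l, Measurable fun a => f a l) : Measurable fun a => gtDens r K (f a) := by
  classical
  refine Measurable.ite ?_ (ENNReal.measurable_ofReal.comp ?_) measurable_const
  · have : {a | Dec (f a)} = ⋂ l, {a | f a (l + 1) ≤ f a l} ∩ {a | 0 ≤ f a l} := by
      ext a
      simp only [Dec, Set.mem_ofPred_eq, Set.mem_iInter, Set.mem_inter_iff]
      exact ⟨fun h l => ⟨h.1 (Nat.le_succ l), h.2 l⟩,
        fun h => ⟨antitone_nat_of_succ_le fun l => (h l).1, fun l => (h l).2⟩⟩
    rw [this]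
    exact MeasurableSet.iInter fun l => (measurableSet_le (hf _) (hf _)).inter
      (measurableSet_le measurable_const (hf _))
  · unfold gtVol diffProd
    refine measurable_const.mul (Measurable.mul ?_ ?_)
    · exact Finset.measurable_fun_prod _ fun i _ => (hf _).pow_const _
    · exact Finset.measurable_fun_prod _ fun i _ =>
        Finset.measurable_fun_prod _ fun j _ => (hf _).sub (hf _)

section Marginal

variable {ι : Type*}

/-- The terms `t (c q 0), t (c q 1), …`, of which there are `min q K`, padded with zeros. -/
def gtRow (K : ℕ) (c : ℕ → ℕ → ι) (q : ℕ) (t : ι → ℝ) : ℕ → ℝ :=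
  pad fun i : Fin (min q K) => t (c q i)

lemma gtRow_congr {K : ℕ} {c : ℕ → ℕ → ι} {q : ℕ} {t t' : ι → ℝ}
    (h : ∀ l < min q K, t (c q l) = t' (c q l)) : gtRow K c q t = gtRow K c q t' := by
  unfold gtRow
  congr 1
  exact funext fun i => h i i.2

lemma measurable_pad {k : ℕ} (l : ℕ) : Measurable fun x : Fin k → ℝ => pad x l := by
  unfold pad
  split_ifs
  · exact measurable_pi_apply _
  · exact measurable_const

lemma measurable_gtRow (K : ℕ) (c : ℕ → ℕ → ι) (q l : ℕ) :
    Measurable fun t : ι → ℝ => gtRow K c q t l :=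
  (measurable_pad l).comp (measurable_pi_lambda _ fun _ => measurable_pi_apply _)

variable [DecidableEq ι]

lemma lmarginal_mul_right {S : Finset ι} {A B : (ι → ℝ) → ENNReal} (hA : Measurable A)
    (hB : ∀ t t', (∀ p ∉ S, t p = t' p) → B t = B t') :
    (∫⋯∫⁻_S, (fun t => A t * B t)) = fun t => (∫⋯∫⁻_S, A) t * B t := by
  funext t
  unfold lmarginal
  have : ∀ y, B (Function.updateFinset t S y) = B t := fun y => hB _ _ fun p hp => by
    simp [Function.updateFinset, hp]
  simp only [this]
  rw [lintegral_mul_const]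
  exact hA.comp measurable_updateFinset

lemma lmarginal_image_eq {κ : Type*} [Fintype κ] [DecidableEq κ] {φ : κ → ι}
    (hφ : Function.Injective φ) {f : (ι → ℝ) → ENNReal} {F : (κ → ℝ) → ENNReal}
    (hF : Measurable F) (t : ι → ℝ)
    (h : ∀ t', (∀ p ∉ Finset.univ.image φ, t' p = t p) → f t' = F (t' ∘ φ)) :
    (∫⋯∫⁻_Finset.univ.image φ, f) t = ∫⁻ x, F x := by
  have h1 : (∫⋯∫⁻_Finset.univ.image φ, f) t =
      (∫⋯∫⁻_Finset.univ.image φ, fun t => F (t ∘ φ)) t := by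
    unfold lmarginal
    refine lintegral_congr fun y => h _ fun p hp => ?_
    simp only [Function.updateFinset, hp, dite_false]
  rw [h1]
  have h2 := lmarginal_image (μ := fun _ : ι => (volume : Measure ℝ)) hφ Finset.univ hF t
  refine h2.trans ?_
  rw [lmarginal_univ]
  rfl

lemma map_comp_withDensity [Fintype ι] {κ : Type*} [Fintype κ] [DecidableEq κ] {φ : κ → ι}
    (hφ : Function.Injective φ) {g : (ι → ℝ) → ENNReal} {h : (κ → ℝ) → ENNReal}
    (hg : Measurable g) (hh : Measurable h)
    (hm : ∀ t, (∫⋯∫⁻_(Finset.univ.image φ)ᶜ, g) t = h (t ∘ φ)) :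
    ((volume : Measure (ι → ℝ)).withDensity g).map (fun t => t ∘ φ) =
      (volume : Measure (κ → ℝ)).withDensity h := by
  have hφm : Measurable fun t : ι → ℝ => t ∘ φ :=
    measurable_pi_lambda _ fun i => measurable_pi_apply _
  ext B hB
  rw [Measure.map_apply hφm hB, withDensity_apply _ (hφm hB), withDensity_apply _ hB,
    ← lintegral_indicator (hφm hB), ← lintegral_indicator hB]
  have hind : Measurable fun t : ι → ℝ => B.indicator (1 : (κ → ℝ) → ENNReal) (t ∘ φ) :=
    (measurable_one.indicator hB).comp hφm
  have hgi : Measurable fun t : ι → ℝ => g t * B.indicator (1 : (κ → ℝ) → ENNReal) (t ∘ φ) :=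
    hg.mul hind
  have e1 : ((fun t : ι → ℝ => t ∘ φ) ⁻¹' B).indicator g =
      fun t => g t * B.indicator (1 : (κ → ℝ) → ENNReal) (t ∘ φ) := by
    funext t
    by_cases ht : t ∘ φ ∈ B
    · rw [Set.indicator_of_mem (by exact ht), Set.indicator_of_mem ht, Pi.one_apply, mul_one]
    · rw [Set.indicator_of_notMem (by exact ht), Set.indicator_of_notMem ht, mul_zero]
  have hv : (volume : Measure (ι → ℝ)) = Measure.pi fun _ => volume := rfl
  rw [e1, hv, lintegral_eq_lmarginal_univ (fun _ => 0),
    ← Finset.union_compl (Finset.univ.image φ),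
    lmarginal_union _ _ hgi disjoint_compl_right, lmarginal_mul_right hg]
  · have e2 : (fun t => (∫⋯∫⁻_(Finset.univ.image φ)ᶜ, g) t *
        B.indicator (1 : (κ → ℝ) → ENNReal) (t ∘ φ)) = fun t => B.indicator h (t ∘ φ) := by
      funext t
      rw [hm]
      by_cases ht : t ∘ φ ∈ B
      · rw [Set.indicator_of_mem ht, Set.indicator_of_mem ht, Pi.one_apply, mul_one]
      · rw [Set.indicator_of_notMem ht, Set.indicator_of_notMem ht, mul_zero]
    rw [e2]
    exact lmarginal_image_eq hφ (hh.indicator hB) _ fun _ _ => rfl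
  · intro t t' ht
    have : t ∘ φ = t' ∘ φ := funext fun i => ht _ (by simp)
    rw [this]

/-- The coordinates of the first `r` rows of a chain. -/
def gtCoords (K : ℕ) (c : ℕ → ℕ → ι) : ℕ → Finset ι
  | 0 => ∅
  | r + 1 => Finset.univ.image (fun i : Fin (min r K) => c r i) ∪ gtCoords K c r

/-- The coordinates of the first `r + 1` rows of a chain are distinct. -/
def DistinctCoords (K : ℕ) (c : ℕ → ℕ → ι) (r : ℕ) : Prop :=
  ∀ q q' l l', q ≤ r → q' ≤ r → l < min q K → l' < min q' K → c q l = c q' l' → q = q' ∧ l = l'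

lemma mem_gtCoords {K : ℕ} {c : ℕ → ℕ → ι} {r : ℕ} {p : ι} :
    p ∈ gtCoords K c r ↔ ∃ q < r, ∃ l < min q K, c q l = p := by
  induction r with
  | zero => simp [gtCoords]
  | succ r ih =>
    rw [gtCoords, Finset.mem_union, ih, Finset.mem_image]
    constructor
    · rintro (⟨i, _, rfl⟩ | ⟨q, hq, l, hl, rfl⟩)
      · exact ⟨r, Nat.lt_succ_self r, i, i.2, rfl⟩
      · exact ⟨q, by omega, l, hl, rfl⟩
    · rintro ⟨q, hq, l, hl, rfl⟩
      rcases Nat.lt_succ_iff_lt_or_eq.1 hq with h | rfl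
      · exact Or.inr ⟨q, h, l, hl, rfl⟩
      · exact Or.inl ⟨⟨l, hl⟩, Finset.mem_univ _, rfl⟩

lemma gtDens_zero (K : ℕ) : gtDens 0 K 0 = 1 := by
  rw [gtDens, if_pos ⟨fun _ _ _ => le_rfl, fun _ => le_rfl⟩, gtVol, Nat.zero_min]
  simp [diffProd, superfact]

theorem lmarginal_chain {K : ℕ} {c : ℕ → ℕ → ι} {r : ℕ} (hc : DistinctCoords K c r) :
    (∫⋯∫⁻_gtCoords K c r, fun t : ι → ℝ =>
      ∏ q ∈ Finset.range r, precInd (gtRow K c q t) (gtRow K c (q + 1) t)) =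
      fun t => gtDens r K (gtRow K c r t) := by
  induction r with
  | zero =>
    rw [gtCoords, lmarginal_empty]
    funext t
    have : gtRow K c 0 t = 0 := by
      funext l
      exact pad_of_le _ (by omega)
    rw [Finset.range_zero, Finset.prod_empty, this, gtDens_zero]
  | succ r ih =>
    have hm1 : ∀ q, Measurable fun t : ι → ℝ => precInd (gtRow K c q t) (gtRow K c (q + 1) t) :=
      fun q => measurable_precInd (measurable_gtRow K c q) (measurable_gtRow K c (q + 1))
    simp only [Finset.prod_range_succ]
    rw [gtCoords, lmarginal_union, lmarginal_mul_right, ih]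
    · funext t
      rw [lmarginal_image_eq (F := fun x => precInd (pad x) (gtRow K c (r + 1) t) *
        gtDens r K (pad x))]
      · exact lintegral_gtDens rfl fun l hl => pad_of_le _ hl
      · intro i j hij
        exact Fin.ext (hc r r i j (by omega) (by omega) i.2 j.2 hij).2
      · exact (measurable_precInd (g := fun _ => gtRow K c (r + 1) t) measurable_pad
          fun l => measurable_const).mul
          (measurable_gtDens r K measurable_pad)
      · intro t' ht
        rw [mul_comm]
        congr 2
        refine gtRow_congr fun l hl => ht _ ?_
        rw [Finset.mem_image]
        rintro ⟨i, _, hi⟩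
        have := (hc r (r + 1) i l (by omega) le_rfl i.2 hl hi).1
        omega
    · exact fun q q' l l' h h' => hc q q' l l' (by omega) (by omega)
    · exact Finset.measurable_fun_prod _ fun q _ => hm1 q
    · intro t t' ht
      have : ∀ q, r ≤ q → q ≤ r + 1 → gtRow K c q t = gtRow K c q t' := by
        intro q hq hq'
        refine gtRow_congr fun l hl => ht _ ?_
        rw [mem_gtCoords]
        rintro ⟨q', h', l', hl', he⟩
        have := (hc q' q l' l (by omega) (by omega) hl' hl he).1
        omega
      rw [this r (by omega) (by omega), this (r + 1) (by omega) (by omega)]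
    · exact (Finset.measurable_fun_prod _ fun q _ => hm1 q).mul (hm1 r)
    · rw [Finset.disjoint_left]
      intro p hp hp'
      obtain ⟨i, _, rfl⟩ := Finset.mem_image.1 hp
      obtain ⟨q', h', l', hl', he⟩ := mem_gtCoords.1 hp'
      have := (hc q' r l' i (by omega) (by omega) hl' i.2 he).1
      omega

end Marginal

/-! ### Transport of densities -/

lemma map_withDensity_of_comp {α β : Type*} [MeasurableSpace α] [MeasurableSpace β]
    {μ : Measure α} {ν : Measure β} {T : α → β} (hT : MeasurePreserving T μ ν)
    {g : β → ENNReal} (hg : Measurable g) :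
    (μ.withDensity fun a => g (T a)).map T = ν.withDensity g := by
  ext B hB
  rw [Measure.map_apply hT.measurable hB, withDensity_apply _ (hT.measurable hB),
    withDensity_apply _ hB, ← hT.map_eq, setLIntegral_map hB hg hT.measurable]

lemma map_equiv_withDensity {α β : Type*} [MeasurableSpace α] [MeasurableSpace β]
    (μ : Measure α) (e : α ≃ᵐ β) (g : β → ENNReal) :
    (μ.withDensity fun a => g (e a)).map e = (μ.map e).withDensity g := by
  ext B hB
  rw [e.map_apply, withDensity_apply _ (e.measurable hB), withDensity_apply _ hB,
    e.restrict_map, lintegral_map_equiv]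

lemma HasDensity.comp_equiv {Ω E F : Type*} [MeasurableSpace Ω] [MeasureSpace E] [MeasureSpace F]
    {P : Measure Ω} {Y : Ω → E} {f : E → ℝ} (h : HasDensity P Y f) (e : E ≃ᵐ F)
    (he : MeasurePreserving e volume volume) (g : F → ℝ) (hg : ∀ y, g (e y) = f y) :
    HasDensity P (fun ω => e (Y ω)) g := by
  have h1 : HasLaw e (volume.withDensity fun y => ENNReal.ofReal (g y))
      (volume.withDensity fun y => ENNReal.ofReal (f y)) := by
    refine ⟨e.measurable.aemeasurable, ?_⟩
    simp only [← hg]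
    rw [map_equiv_withDensity volume e fun y => ENNReal.ofReal (g y), he.map_eq]
  exact h1.fun_comp h

lemma HasDensity.congr_ae {Ω E : Type*} [MeasurableSpace Ω] [MeasureSpace E]
    {P : Measure Ω} {Y Y' : Ω → E} {f f' : E → ℝ} (h : HasDensity P Y f) (hY : Y' =ᵐ[P] Y)
    (hf : f =ᵐ[volume] f') : HasDensity P Y' f' := by
  have h' := HasLaw.congr h hY
  unfold HasDensity
  have e : (volume : Measure E).withDensity (fun y => ENNReal.ofReal (f y)) =
      volume.withDensity fun y => ENNReal.ofReal (f' y) :=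
    withDensity_congr_ae (hf.fun_comp ENNReal.ofReal)
  rwa [← e]

lemma HasDensity.smul {Ω : Type*} [MeasurableSpace Ω] {P : Measure Ω} {ι : Type*} [Fintype ι]
    {Y : Ω → ι → ℝ} {f : (ι → ℝ) → ℝ} (h : HasDensity P Y f) {r : ℝ} (hr : 0 < r) :
    HasDensity P (fun ω => r • Y ω) fun x => (r ^ Fintype.card ι)⁻¹ * f (r⁻¹ • x) := by
  let e : (ι → ℝ) ≃ᵐ (ι → ℝ) := (Homeomorph.smulOfNeZero r hr.ne').toMeasurableEquiv
  have h1 : HasLaw (fun x : ι → ℝ => r • x)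
      (volume.withDensity fun x => ENNReal.ofReal ((r ^ Fintype.card ι)⁻¹ * f (r⁻¹ • x)))
      (volume.withDensity fun x => ENNReal.ofReal (f x)) := by
    refine ⟨(measurable_const_smul r).aemeasurable, ?_⟩
    have h2 := map_equiv_withDensity (volume : Measure (ι → ℝ)) e
      fun x => ENNReal.ofReal (f (r⁻¹ • x))
    have h3 : ∀ x, e x = r • x := fun _ => rfl
    have h4 : (volume : Measure (ι → ℝ)).map e =
        ENNReal.ofReal ((r ^ Fintype.card ι)⁻¹) • (volume : Measure (ι → ℝ)) := by
      have := Measure.map_addHaar_smul (volume : Measure (ι → ℝ)) hr.ne'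
      rw [Module.finrank_fintype_fun_eq_card, abs_of_pos (by positivity)] at this
      exact this
    rw [h4] at h2
    simp only [h3, inv_smul_smul₀ hr.ne'] at h2
    rw [show (fun x : ι → ℝ => r • x) = e from rfl, h2, withDensity_smul_measure,
      ← withDensity_smul' _ _ ENNReal.ofReal_ne_top]
    congr 1
    funext x
    rw [Pi.smul_apply, smul_eq_mul, ENNReal.ofReal_mul (by positivity)]
  exact h1.fun_comp h

/-! ### The law of a vector of independent exponential variables -/

lemma lmarginal_prod {ι : Type*} [DecidableEq ι] {f : ι → ℝ → ENNReal}
    (hf : ∀ i, Measurable (f i)) (S : Finset ι) :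
    (∫⋯∫⁻_S, fun t : ι → ℝ => ∏ i ∈ S, f i (t i)) = fun _ => ∏ i ∈ S, ∫⁻ x, f i x := by
  induction S using Finset.induction_on with
  | empty => simp
  | insert i S hi ih =>
    have hm : ∀ S : Finset ι, Measurable fun t : ι → ℝ => ∏ i ∈ S, f i (t i) := fun S =>
      Finset.measurable_fun_prod _ fun i _ => (hf i).comp (measurable_pi_apply i)
    funext t
    rw [lmarginal_insert _ (hm _) hi]
    simp only [Finset.prod_insert hi]
    have h1 : (∫⋯∫⁻_S, fun t : ι → ℝ => f i (t i) * ∏ i ∈ S, f i (t i)) =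
        fun t => (∏ i ∈ S, ∫⁻ x, f i x) * f i (t i) := by
      simp only [mul_comm (f i _)]
      rw [lmarginal_mul_right (hm S) fun t t' h => by rw [h i hi], ih]
    simp only [h1, Function.update_self]
    rw [lintegral_const_mul _ (hf i), mul_comm]

lemma pi_withDensity {ι : Type*} [Fintype ι] [DecidableEq ι] {f : ι → ℝ → ENNReal}
    (hf : ∀ i, Measurable (f i)) [∀ i, SigmaFinite ((volume : Measure ℝ).withDensity (f i))] :
    Measure.pi (fun i => (volume : Measure ℝ).withDensity (f i)) =
      (volume : Measure (ι → ℝ)).withDensity fun t => ∏ i, f i (t i) := by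
  refine Measure.pi_eq fun s hs => ?_
  rw [withDensity_apply _ (MeasurableSet.univ_pi hs),
    ← lintegral_indicator (MeasurableSet.univ_pi hs)]
  have e : (Set.pi Set.univ s).indicator (fun t : ι → ℝ => ∏ i, f i (t i)) =
      fun t => ∏ i, (s i).indicator (f i) (t i) := by
    funext t
    by_cases ht : t ∈ Set.pi Set.univ s
    · rw [Set.indicator_of_mem ht]
      exact Finset.prod_congr rfl fun i _ => (Set.indicator_of_mem (ht i (Set.mem_univ i)) _).symm
    · rw [Set.indicator_of_notMem ht]
      simp only [Set.mem_univ_pi, not_forall] at ht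
      obtain ⟨i, hi⟩ := ht
      exact (Finset.prod_eq_zero (Finset.mem_univ i) (Set.indicator_of_notMem hi _)).symm
  rw [e, volume_pi, lintegral_eq_lmarginal_univ (fun _ => 0),
    lmarginal_prod fun i => (hf i).indicator (hs i)]
  exact Finset.prod_congr rfl fun i _ => by
    rw [lintegral_indicator (hs i), withDensity_apply _ (hs i)]

open Classical in
lemma hasLaw_expVector {Ω ι : Type*} [MeasurableSpace Ω] {P : Measure Ω} [Fintype ι]
    {rate : ι → ℝ} (hr : ∀ i, 0 < rate i) {Y : ι → Ω → ℝ}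
    (hY : ∀ i, HasLaw (Y i) (expMeasure (rate i)) P) (hind : iIndepFun Y P) :
    HasLaw (fun ω i => Y i ω) ((volume : Measure (ι → ℝ)).withDensity fun t =>
      if ∀ i, 0 ≤ t i then ENNReal.ofReal ((∏ i, rate i) * Real.exp (-∑ i, rate i * t i)) else 0)
      P := by
  have h := hind.hasLaw_pi hY
  have hs : ∀ i, IsProbabilityMeasure
      ((volume : Measure ℝ).withDensity (gammaPDF 1 (rate i))) :=
    fun i => isProbabilityMeasure_expMeasure (hr i)
  have e : Measure.pi (fun i => expMeasure (rate i)) =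
      (volume : Measure (ι → ℝ)).withDensity fun t => ∏ i, exponentialPDF (rate i) (t i) :=
    pi_withDensity fun i => (measurable_gammaPDFReal 1 (rate i)).ennreal_ofReal
  rw [e] at h
  convert h using 2
  congr 1
  funext t
  split_ifs with ht
  · rw [← Finset.sum_neg_distrib, Real.exp_sum, ← Finset.prod_mul_distrib,
      ENNReal.ofReal_prod_of_nonneg]
    · refine Finset.prod_congr rfl fun i _ => ?_
      rw [exponentialPDF_of_nonneg (ht i)]
    · intro i _
      have := hr i
      positivity
  · push Not at ht
    obtain ⟨i, hi⟩ := ht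
    exact (Finset.prod_eq_zero (Finset.mem_univ i) (exponentialPDF_of_neg hi)).symm

lemma ae_apply_ne {κ : Type*} [Fintype κ] : ∀ᵐ t : κ → ℝ, (∀ p q, p ≠ q → t p ≠ t q) ∧
    ∀ p, t p ≠ 0 := by
  classical
  rw [Filter.eventually_and]
  constructor
  · refine ae_all_iff.2 fun p => ae_all_iff.2 fun q => ?_
    by_cases hpq : p = q
    · exact Filter.Eventually.of_forall fun t h => absurd hpq h
    · let L : (κ → ℝ) →ₗ[ℝ] ℝ := LinearMap.proj (R := ℝ) (φ := fun _ : κ => ℝ) p - LinearMap.proj q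
      have h := Measure.addHaar_submodule (volume : Measure (κ → ℝ)) (LinearMap.ker L) (by
        intro h
        have h1 : (Pi.single p 1 : κ → ℝ) ∈ LinearMap.ker L := h ▸ Submodule.mem_top
        simp [L, Ne.symm hpq] at h1)
      have h2 : ∀ᵐ t : κ → ℝ, t ∉ (LinearMap.ker L : Set (κ → ℝ)) := measure_eq_zero_iff_ae_notMem.1 h
      filter_upwards [h2] with t ht _ he
      exact ht (by simp [L, he])
  · exact ae_all_iff.2 fun p => Measure.ae_eval_ne (μ := fun _ : κ => (volume : Measure ℝ)) p (0 : ℝ)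

/-! ### The rectangular case -/

lemma precInd_of_prec {u v : ℕ → ℝ} (h : Prec u v) : precInd u v = 1 := by
  rw [precInd, if_pos h]

lemma precInd_of_not_prec {u v : ℕ → ℝ} (h : ¬ Prec u v) : precInd u v = 0 := by
  rw [precInd, if_neg h]

open Classical in
lemma prod_precInd {r : ℕ} (u : ℕ → ℕ → ℝ) :
    ∏ q ∈ Finset.range r, precInd (u q) (u (q + 1)) =
      if ∀ q < r, Prec (u q) (u (q + 1)) then 1 else 0 := by
  split_ifs with h
  · exact Finset.prod_eq_one fun q hq => precInd_of_prec (h q (Finset.mem_range.1 hq))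
  · push Not at h
    obtain ⟨q, hq, hn⟩ := h
    exact Finset.prod_eq_zero (Finset.mem_range.2 hq) (precInd_of_not_prec hn)

lemma Chart.gtRow_flow_left {ι : Type*} {m n : ℕ} (c : Chart ι m n) (σ : ℕ → ℕ → ι) {q : ℕ}
    (hq : q ≤ m) (hσ : ∀ l < min q n, c.row (σ q l) = q - 1 - l ∧ c.col (σ q l) = n - 1 - l)
    (t : ι → ℝ) : gtRow n σ q (c.flow (m + n) t) = lam (c.emb t) q n := by
  funext l
  rcases lt_or_ge l (min q n) with hl | hl
  · obtain ⟨h1, h2⟩ := hσ l hl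
    rw [gtRow, pad, dif_pos hl, Chart.flow, h1, h2,
      stage_final _ (k := l) (by omega) (by omega) (by omega),
      show q - 1 - l + l + 1 = q by omega, show n - 1 - l + l + 1 = n by omega]
  · rw [gtRow, pad_of_le _ hl, lam_eq_zero_of_le _ _ _ _ hl]

lemma Chart.gtRow_flow_right {ι : Type*} {m n : ℕ} (c : Chart ι m n) (σ : ℕ → ℕ → ι) {q : ℕ}
    (hq : q ≤ n) (hσ : ∀ l < min q m, c.row (σ q l) = m - 1 - l ∧ c.col (σ q l) = q - 1 - l)
    (t : ι → ℝ) : gtRow m σ q (c.flow (m + n) t) = lam (c.emb t) m q := by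
  funext l
  rcases lt_or_ge l (min q m) with hl | hl
  · obtain ⟨h1, h2⟩ := hσ l hl
    rw [gtRow, pad, dif_pos hl, Chart.flow, h1, h2,
      stage_final _ (k := l) (by omega) (by omega) (by omega),
      show q - 1 - l + l + 1 = q by omega, show m - 1 - l + l + 1 = m by omega]
  · rw [gtRow, pad_of_le _ hl, lam_eq_zero_of_le _ _ _ _ (by omega)]

/-- The site `(i, j)`. -/
def rectSite (m n : ℕ) [NeZero m] [NeZero n] (i j : ℕ) : Fin m × Fin n :=
  (Fin.ofNat m i, Fin.ofNat n j)

/-- The sites carrying the shapes at the corners `(q, n)`. -/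
def rectLeft (m n : ℕ) [NeZero m] [NeZero n] (q l : ℕ) : Fin m × Fin n :=
  rectSite m n (q - 1 - l) (n - 1 - l)

/-- The sites carrying the shapes at the corners `(m, q)`. -/
def rectRight (m n : ℕ) [NeZero m] [NeZero n] (q l : ℕ) : Fin m × Fin n :=
  rectSite m n (m - 1 - l) (q - 1 - l)

section Rect

variable {m n : ℕ} [NeZero m]

lemma rectSite_eq_iff [NeZero n] {i j : ℕ} (hi : i < m) (hj : j < n) (p : Fin m × Fin n) :
    rectSite m n i j = p ↔ (p.1 : ℕ) = i ∧ (p.2 : ℕ) = j := by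
  rw [Prod.ext_iff, Fin.ext_iff, Fin.ext_iff]
  simp only [rectSite, Fin.val_ofNat, Nat.mod_eq_of_lt hi, Nat.mod_eq_of_lt hj]
  exact and_congr eq_comm eq_comm

lemma rectLeft_eq_iff [NeZero n] {q l : ℕ} (hq : q ≤ m) (hl : l < min q n) (p : Fin m × Fin n) :
    rectLeft m n q l = p ↔ (p.1 : ℕ) = q - 1 - l ∧ (p.2 : ℕ) = n - 1 - l :=
  rectSite_eq_iff (by omega) (by omega) p

lemma rectRight_eq_iff [NeZero n] {q l : ℕ} (hq : q ≤ n) (hl : l < min q m) (p : Fin m × Fin n) :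
    rectRight m n q l = p ↔ (p.1 : ℕ) = m - 1 - l ∧ (p.2 : ℕ) = q - 1 - l :=
  rectSite_eq_iff (by omega) (by omega) p

lemma distinctCoords_rectLeft [NeZero n] : DistinctCoords n (rectLeft m n) m := by
  intro q q' l l' hq hq' hl hl' h
  have h1 := (rectLeft_eq_iff hq hl _).1 h
  have h2 := (rectLeft_eq_iff hq' hl' _).1 rfl
  omega

lemma distinctCoords_rectRight [NeZero n] {r : ℕ} (hr : r ≤ n) :
    DistinctCoords m (rectRight m n) r := by
  intro q q' l l' hq hq' hl hl' h
  have h1 := (rectRight_eq_iff (hq.trans hr) hl _).1 h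
  have h2 := (rectRight_eq_iff (hq'.trans hr) hl' _).1 rfl
  omega

lemma rectLeft_ne_rectRight [NeZero n] {q q' l l' : ℕ} (hq : q ≤ m) (hq' : q' ≤ n)
    (hqq : q < m ∨ q' < n) (hl : l < min q n) (hl' : l' < min q' m) :
    rectLeft m n q l ≠ rectRight m n q' l' := by
  intro h
  have h1 := (rectLeft_eq_iff hq hl _).1 h
  have h2 := (rectRight_eq_iff hq' hl' _).1 rfl
  omega

/-- The sites which carry the shapes at the corners `(m, n + 1)` and `(m, n)`. -/
def rectOuter (m n : ℕ) [NeZero m] :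
    Fin (min m (n + 1)) ⊕ Fin (min n m) → Fin m × Fin (n + 1) :=
  Sum.elim (fun l => rectLeft m (n + 1) m l) (fun l => rectRight m (n + 1) n l)

lemma rectOuter_injective : Function.Injective (rectOuter m n) := by
  rintro (a | a) (b | b) h
  · exact congrArg _ (Fin.ext (distinctCoords_rectLeft m m a b le_rfl le_rfl a.2 b.2 h).2)
  · exact absurd h (rectLeft_ne_rectRight le_rfl (by omega) (by omega) a.2 b.2)
  · exact absurd h.symm (rectLeft_ne_rectRight le_rfl (by omega) (by omega) b.2 a.2)
  · exact congrArg _ (Fin.ext (distinctCoords_rectRight (by omega) n n a b le_rfl le_rfl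
      a.2 b.2 h).2)

lemma compl_image_rectOuter : (Finset.univ.image (rectOuter m n))ᶜ =
    gtCoords (n + 1) (rectLeft m (n + 1)) m ∪ gtCoords m (rectRight m (n + 1)) n := by
  ext p
  rw [Finset.mem_compl, Finset.mem_union, mem_gtCoords, mem_gtCoords, Finset.mem_image]
  constructor
  · intro h
    have hp1 := p.1.2
    have hp2 := p.2.2
    rcases lt_or_ge ((p.1 : ℕ) + (n - p.2)) m with h1 | h1
    · rcases eq_or_ne ((p.1 : ℕ) + (n - p.2) + 1) m with h2 | h2
      · refine absurd ⟨Sum.inl ⟨n - p.2, by omega⟩, Finset.mem_univ _, ?_⟩ h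
        exact (rectLeft_eq_iff le_rfl (by simp; omega) p).2 ⟨by simp; omega, by simp; omega⟩
      · refine Or.inl ⟨p.1 + (n - p.2) + 1, by omega, n - p.2, by omega, ?_⟩
        exact (rectLeft_eq_iff (by omega) (by omega) p).2 ⟨by omega, by omega⟩
    · rcases eq_or_ne ((p.2 : ℕ) + (m - 1 - p.1) + 1) n with h2 | h2
      · refine absurd ⟨Sum.inr ⟨m - 1 - p.1, by omega⟩, Finset.mem_univ _, ?_⟩ h
        exact (rectRight_eq_iff (by omega) (by simp; omega) p).2 ⟨by simp; omega, by simp; omega⟩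
      · refine Or.inr ⟨p.2 + (m - 1 - p.1) + 1, by omega, m - 1 - p.1, by omega, ?_⟩
        exact (rectRight_eq_iff (by omega) (by omega) p).2 ⟨by omega, by omega⟩
  · rintro h ⟨i | i, -, hi⟩
    · rcases h with ⟨q, hq, l, hl, he⟩ | ⟨q, hq, l, hl, he⟩
      · have := (distinctCoords_rectLeft q m l i hq.le le_rfl hl i.2 (he.trans hi.symm)).1
        omega
      · exact rectLeft_ne_rectRight le_rfl (by omega) (by omega) i.2 hl (hi.trans he.symm)
    · rcases h with ⟨q, hq, l, hl, he⟩ | ⟨q, hq, l, hl, he⟩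
      · exact rectLeft_ne_rectRight hq.le (by omega) (by omega) hl i.2 (he.trans hi.symm)
      · have := (distinctCoords_rectRight (by omega) q n l i hq.le le_rfl hl i.2
          (he.trans hi.symm)).1
        omega

/-- The weight of a pair of shapes in the rectangular case. -/
def rectWeight (a a₁ : ℝ) (m n : ℕ) (x y : ℕ → ℝ) : ENNReal :=
  ENNReal.ofReal ((2 * a) ^ (m * n) * (a + a₁) ^ m *
    Real.exp (-((a + a₁) * ∑ l ∈ Finset.range (min m (n + 1)), x l +
      (a - a₁) * ∑ l ∈ Finset.range (min n m), y l))) * precInd y x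

omit [NeZero m] in
lemma measurable_rectWeight {α : Type*} [MeasurableSpace α] (a a₁ : ℝ) {x y : α → ℕ → ℝ}
    (hx : ∀ l, Measurable fun a => x a l) (hy : ∀ l, Measurable fun a => y a l) :
    Measurable fun s => rectWeight a a₁ m n (x s) (y s) := by
  unfold rectWeight
  refine Measurable.mul ?_ (measurable_precInd hy hx)
  have h1 : Measurable fun s => ∑ l ∈ Finset.range (min m (n + 1)), x s l :=
    Finset.measurable_fun_sum _ fun l _ => hx l
  have h2 : Measurable fun s => ∑ l ∈ Finset.range (min n m), y s l :=
    Finset.measurable_fun_sum _ fun l _ => hy l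
  fun_prop

/-- The density of the image of the matrix under the correspondence. -/
def rectImageDens (a a₁ : ℝ) (m n : ℕ) [NeZero m] (s : Fin m × Fin (n + 1) → ℝ) : ENNReal :=
  (∏ q ∈ Finset.range n, precInd (gtRow m (rectRight m (n + 1)) q s)
    (gtRow m (rectRight m (n + 1)) (q + 1) s)) *
  ((∏ q ∈ Finset.range m, precInd (gtRow (n + 1) (rectLeft m (n + 1)) q s)
    (gtRow (n + 1) (rectLeft m (n + 1)) (q + 1) s)) *
  rectWeight a a₁ m n (gtRow (n + 1) (rectLeft m (n + 1)) m s)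
    (gtRow m (rectRight m (n + 1)) n s))

lemma measurable_prod_precInd {ι : Type*} (K r : ℕ) (c : ℕ → ℕ → ι) :
    Measurable fun t : ι → ℝ =>
      ∏ q ∈ Finset.range r, precInd (gtRow K c q t) (gtRow K c (q + 1) t) :=
  Finset.measurable_fun_prod _ fun q _ =>
    measurable_precInd (measurable_gtRow K c q) (measurable_gtRow K c (q + 1))

lemma measurable_rectImageDens (a a₁ : ℝ) : Measurable (rectImageDens a a₁ m n) :=
  (measurable_prod_precInd _ _ _).mul ((measurable_prod_precInd _ _ _).mul
    (measurable_rectWeight a a₁ (measurable_gtRow _ _ _) (measurable_gtRow _ _ _)))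

/-- The joint density of the shapes at the corners `(m, n + 1)` and `(m, n)`. -/
def rectShapeDens (a a₁ : ℝ) (m n : ℕ) (v : Fin (min m (n + 1)) ⊕ Fin (min n m) → ℝ) : ENNReal :=
  gtDens m (n + 1) (pad (v ∘ Sum.inl)) *
    (rectWeight a a₁ m n (pad (v ∘ Sum.inl)) (pad (v ∘ Sum.inr)) *
      gtDens n m (pad (v ∘ Sum.inr)))

lemma lmarginal_rectImageDens (a a₁ : ℝ) (t : Fin m × Fin (n + 1) → ℝ) :
    (∫⋯∫⁻_(Finset.univ.image (rectOuter m n))ᶜ, rectImageDens a a₁ m n) t =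
      rectShapeDens a a₁ m n (t ∘ rectOuter m n) := by
  have hx : ∀ t : Fin m × Fin (n + 1) → ℝ, pad ((t ∘ rectOuter m n) ∘ Sum.inl) =
      gtRow (n + 1) (rectLeft m (n + 1)) m t := fun t => rfl
  have hy : ∀ t : Fin m × Fin (n + 1) → ℝ, pad ((t ∘ rectOuter m n) ∘ Sum.inr) =
      gtRow m (rectRight m (n + 1)) n t := fun t => rfl
  have hdisj : Disjoint (gtCoords (n + 1) (rectLeft m (n + 1)) m)
      (gtCoords m (rectRight m (n + 1)) n) := by
    rw [Finset.disjoint_left]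
    intro p hp hp'
    obtain ⟨q, hq, l, hl, he⟩ := mem_gtCoords.1 hp
    obtain ⟨q', hq', l', hl', he'⟩ := mem_gtCoords.1 hp'
    exact rectLeft_ne_rectRight hq.le (by omega) (by omega) hl hl' (he.trans he'.symm)
  have left_indep : ∀ t t' : Fin m × Fin (n + 1) → ℝ,
      (∀ p ∉ gtCoords m (rectRight m (n + 1)) n, t p = t' p) → ∀ q ≤ m,
      gtRow (n + 1) (rectLeft m (n + 1)) q t = gtRow (n + 1) (rectLeft m (n + 1)) q t' := by
    intro t t' h q hq
    refine gtRow_congr fun l hl => h _ fun hmem => ?_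
    obtain ⟨q', hq', l', hl', he'⟩ := mem_gtCoords.1 hmem
    exact rectLeft_ne_rectRight hq (by omega) (by omega) hl hl' he'.symm
  have top_right : ∀ t t' : Fin m × Fin (n + 1) → ℝ,
      (∀ p ∉ gtCoords m (rectRight m (n + 1)) n, t p = t' p) →
      gtRow m (rectRight m (n + 1)) n t = gtRow m (rectRight m (n + 1)) n t' := by
    intro t t' h
    refine gtRow_congr fun l hl => h _ fun hmem => ?_
    obtain ⟨q', hq', l', hl', he'⟩ := mem_gtCoords.1 hmem
    have := (distinctCoords_rectRight (by omega) q' n l' l hq'.le le_rfl hl' hl he').1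
    omega
  have top_left : ∀ t t' : Fin m × Fin (n + 1) → ℝ,
      (∀ p ∉ gtCoords (n + 1) (rectLeft m (n + 1)) m, t p = t' p) →
      gtRow (n + 1) (rectLeft m (n + 1)) m t = gtRow (n + 1) (rectLeft m (n + 1)) m t' := by
    intro t t' h
    refine gtRow_congr fun l hl => h _ fun hmem => ?_
    obtain ⟨q', hq', l', hl', he'⟩ := mem_gtCoords.1 hmem
    have := (distinctCoords_rectLeft q' m l' l hq'.le le_rfl hl' hl he').1
    omega
  have right_indep : ∀ t t' : Fin m × Fin (n + 1) → ℝ,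
      (∀ p ∉ gtCoords (n + 1) (rectLeft m (n + 1)) m, t p = t' p) →
      gtRow m (rectRight m (n + 1)) n t = gtRow m (rectRight m (n + 1)) n t' := by
    intro t t' h
    refine gtRow_congr fun l hl => h _ fun hmem => ?_
    obtain ⟨q', hq', l', hl', he'⟩ := mem_gtCoords.1 hmem
    exact rectLeft_ne_rectRight hq'.le (by omega) (by omega) hl' hl he'
  rw [compl_image_rectOuter, lmarginal_union _ _ (measurable_rectImageDens a a₁) hdisj]
  have e1 : (∫⋯∫⁻_gtCoords m (rectRight m (n + 1)) n, rectImageDens a a₁ m n) = fun t =>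
      (∏ q ∈ Finset.range m, precInd (gtRow (n + 1) (rectLeft m (n + 1)) q t)
        (gtRow (n + 1) (rectLeft m (n + 1)) (q + 1) t)) *
      (rectWeight a a₁ m n (gtRow (n + 1) (rectLeft m (n + 1)) m t)
        (gtRow m (rectRight m (n + 1)) n t) * gtDens n m (gtRow m (rectRight m (n + 1)) n t)) := by
    unfold rectImageDens
    rw [lmarginal_mul_right (measurable_prod_precInd _ _ _),
      lmarginal_chain (distinctCoords_rectRight (by omega))]
    · funext t; ring
    · intro t t' h
      have e := left_indep t t' h
      rw [top_right t t' h, e m le_rfl]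
      congr 1
      refine Finset.prod_congr rfl fun q hq => ?_
      have := Finset.mem_range.1 hq
      rw [e q this.le, e (q + 1) this]
  rw [e1, lmarginal_mul_right (measurable_prod_precInd _ _ _),
    lmarginal_chain distinctCoords_rectLeft, rectShapeDens, hx, hy]
  intro t t' h
  rw [top_left t t' h, right_indep t t' h]

omit [NeZero m] in
lemma measurable_rectShapeDens (a a₁ : ℝ) : Measurable (rectShapeDens a a₁ m n) := by
  have h1 : ∀ l, Measurable fun v : Fin (min m (n + 1)) ⊕ Fin (min n m) → ℝ =>
      pad (v ∘ Sum.inl) l := fun l =>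
    (measurable_pad l).comp (measurable_pi_lambda _ fun _ => measurable_pi_apply _)
  have h2 : ∀ l, Measurable fun v : Fin (min m (n + 1)) ⊕ Fin (min n m) → ℝ =>
      pad (v ∘ Sum.inr) l := fun l =>
    (measurable_pad l).comp (measurable_pi_lambda _ fun _ => measurable_pi_apply _)
  exact (measurable_gtDens _ _ h1).mul ((measurable_rectWeight a a₁ h1 h2).mul
    (measurable_gtDens _ _ h2))

/-- The rates of the entries in the rectangular case. -/
def rectRate (a a₁ : ℝ) {m n : ℕ} (p : Fin m × Fin (n + 1)) : ℝ :=
  if p.2 = Fin.last n then a + a₁ else 2 * a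

omit [NeZero m] in
lemma prod_rectRate (a a₁ : ℝ) :
    ∏ p : Fin m × Fin (n + 1), rectRate a a₁ p = (2 * a) ^ (m * n) * (a + a₁) ^ m := by
  rw [Fintype.prod_prod_type]
  simp only [Fin.prod_univ_castSucc, rectRate, (Fin.castSucc_ne_last _), if_true, if_false,
    Finset.prod_const, Finset.card_univ, Fintype.card_fin]
  rw [mul_pow, ← pow_mul, mul_comm n m]

omit [NeZero m] in
lemma sum_rectRate (a a₁ : ℝ) {t : Fin m × Fin (n + 1) → ℝ} (ht : ∀ p, 0 ≤ t p) :
    ∑ p, rectRate a a₁ p * t p =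
      (a + a₁) * ∑ l ∈ Finset.range (min m (n + 1)),
        lam (zeroPad fun i j => t (i, j)) m (n + 1) l +
      (a - a₁) * ∑ l ∈ Finset.range (min n m), lam (zeroPad fun i j => t (i, j)) m n l := by
  have hP := zeroPad_nonneg (X := fun i j => t (i, j)) fun i j => ht (i, j)
  rw [sum_lam hP m (n + 1) le_rfl, sum_lam hP m n (by omega), Fintype.sum_prod_type]
  simp only [Finset.sum_range, Fin.sum_univ_castSucc, rectRate, (Fin.castSucc_ne_last _), if_true,
    if_false]
  have e : ∀ (i : Fin m) (j : Fin (n + 1)), zeroPad (fun i j => t (i, j)) i j = t (i, j) :=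
    fun i j => zeroPad_coe _ i j
  have e1 : ∀ (i : Fin m) (j : Fin n), zeroPad (fun i j => t (i, j)) i j = t (i, j.castSucc) :=
    fun i j => zeroPad_coe (fun i j => t (i, j)) i j.castSucc
  have e2 : ∀ (i : Fin m), zeroPad (fun i j => t (i, j)) i n = t (i, Fin.last n) := fun i =>
    zeroPad_coe (fun i j => t (i, j)) i (Fin.last n)
  simp only [Fin.val_castSucc, Fin.val_last, e1, e2, Finset.mul_sum, ← Finset.sum_add_distrib,
    mul_add]
  refine Finset.sum_congr rfl fun i _ => ?_
  have : ∀ j : Fin n, 2 * a * t (i, j.castSucc) =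
    (a + a₁) * t (i, j.castSucc) + (a - a₁) * t (i, j.castSucc) := fun j => by ring
  simp only [this, Finset.sum_add_distrib]
  ring

open Classical in
lemma rectImageDens_flow (a a₁ : ℝ) (t : Fin m × Fin (n + 1) → ℝ) :
    rectImageDens a a₁ m n ((rectChart m (n + 1)).flow (m + (n + 1)) t) =
      if ∀ p, 0 ≤ t p then ENNReal.ofReal ((∏ p : Fin m × Fin (n + 1), rectRate a a₁ p) *
        Real.exp (-∑ p, rectRate a a₁ p * t p)) else 0 := by
  set X := zeroPad fun i j => t (i, j) with hXdef
  have hA : ∀ q ≤ m, gtRow (n + 1) (rectLeft m (n + 1)) q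
      ((rectChart m (n + 1)).flow (m + (n + 1)) t) = lam X q (n + 1) := fun q hq =>
    (rectChart m (n + 1)).gtRow_flow_left _ hq (fun l hl => (rectLeft_eq_iff hq hl _).1 rfl) t
  have hB : ∀ q ≤ n + 1, gtRow m (rectRight m (n + 1)) q
      ((rectChart m (n + 1)).flow (m + (n + 1)) t) = lam X m q := fun q hq =>
    (rectChart m (n + 1)).gtRow_flow_right _ hq (fun l hl => (rectRight_eq_iff hq hl _).1 rfl) t
  have hiff : (∀ p, 0 ≤ t p) ↔ ∀ i < m, ∀ j < n + 1, 0 ≤ X i j := by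
    constructor
    · intro h i _ j _
      exact zeroPad_nonneg (fun _ _ => h _) i j
    · intro h p
      have := h p.1 p.1.2 p.2 p.2.2
      rwa [hXdef, zeroPad_coe] at this
  rw [← prec_boundary_iff] at hiff
  unfold rectImageDens
  rw [prod_precInd (fun q => gtRow m (rectRight m (n + 1)) q _),
    prod_precInd (fun q => gtRow (n + 1) (rectLeft m (n + 1)) q _), hA m le_rfl,
    hB n (Nat.le_succ n)]
  by_cases ht : ∀ p, 0 ≤ t p
  · obtain ⟨h1, h2⟩ := hiff.1 ht
    rw [if_pos ht, if_pos, if_pos, one_mul, one_mul, rectWeight, prod_rectRate,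
      sum_rectRate a a₁ ht, precInd_of_prec (h2 n (Nat.lt_succ_self n)), mul_one]
    · intro q hq
      rw [hA q hq.le, hA (q + 1) hq]
      exact h1 q hq
    · intro q hq
      rw [hB q (by omega), hB (q + 1) (by omega)]
      exact h2 q (by omega)
  · rw [if_neg ht]
    by_contra hne
    apply ht
    rw [hiff]
    rw [mul_eq_zero, mul_eq_zero, not_or, not_or, ite_eq_right_iff, ite_eq_right_iff,
      rectWeight, mul_eq_zero, not_or] at hne
    obtain ⟨h1, h2, -, h3⟩ := hne
    simp only [one_ne_zero, imp_false, not_not] at h1 h2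
    refine ⟨fun q hq => ?_, fun q hq => ?_⟩
    · have := h2 q hq
      rwa [hA q hq.le, hA (q + 1) hq] at this
    · rcases Nat.lt_succ_iff_lt_or_eq.1 hq with hq | rfl
      · have := h1 q hq
        rwa [hB q (by omega), hB (q + 1) (by omega)] at this
      · by_contra h
        exact h3 (precInd_of_not_prec h)

end Rect

lemma hasLaw_of_isEmpty {Ω κ : Type*} [MeasurableSpace Ω] {P : Measure Ω} [IsProbabilityMeasure P]
    [Fintype κ] [IsEmpty κ] (Y : Ω → κ → ℝ) {h : (κ → ℝ) → ENNReal} (hh : ∀ v, h v = 1) :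
    HasLaw Y ((volume : Measure (κ → ℝ)).withDensity h) P := by
  have e : h = 1 := funext hh
  have hY : Y = fun _ => isEmptyElim := by
    funext ω; exact Subsingleton.elim _ _
  rw [e, withDensity_one, hY]
  refine ⟨measurable_const.aemeasurable, ?_⟩
  rw [Measure.map_const, measure_univ, one_smul, volume_pi, Measure.pi_of_empty _ isEmptyElim]

/-- The joint law of the shapes at the corners `(m, n + 1)` and `(m, n)`. -/
theorem hasLaw_rectShape {Ω : Type*} [MeasurableSpace Ω] {P : Measure Ω} [IsProbabilityMeasure P]
    {a a₁ : ℝ} (ha : 0 < a) (ha₁ : 0 < a + a₁) {m n : ℕ} {X : Fin m → Fin (n + 1) → Ω → ℝ}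
    (hX : IsRectExpMatrix P a a₁ X) :
    HasLaw (fun ω => Sum.elim
        (fun l : Fin (min m (n + 1)) => lam (zeroPad fun i j => X i j ω) m (n + 1) l)
        (fun l : Fin (min n m) => lam (zeroPad fun i j => X i j ω) m n l))
      (volume.withDensity (rectShapeDens a a₁ m n)) P := by
  rcases Nat.eq_zero_or_pos m with rfl | hm
  · have i1 : IsEmpty (Fin (min 0 (n + 1))) := by rw [Nat.zero_min]; infer_instance
    have i2 : IsEmpty (Fin (min n 0)) := by rw [Nat.min_zero]; infer_instance
    refine hasLaw_of_isEmpty _ fun v => ?_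
    have h1 : pad (v ∘ Sum.inl) = 0 := funext fun l => pad_of_le _ (by omega)
    have h2 : pad (v ∘ Sum.inr) = 0 := funext fun l => pad_of_le _ (by omega)
    have h3 : gtDens n 0 0 = 1 := by
      rw [gtDens, if_pos ⟨fun _ _ _ => le_rfl, fun _ => le_rfl⟩, gtVol, Nat.min_zero]
      simp [diffProd, div_self (superfact_pos (n - 1)).ne']
    rw [rectShapeDens, h1, h2, gtDens_zero, h3, rectWeight, precInd_of_prec prec_zero]
    simp
  · have : NeZero m := ⟨hm.ne'⟩
    have hlaw := hasLaw_expVector (P := P) (rate := fun p : Fin m × Fin (n + 1) => rectRate a a₁ p)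
      (Y := fun p => X p.1 p.2) (fun p => by unfold rectRate; split_ifs <;> linarith)
      (fun p => by
        unfold rectRate
        split_ifs with h
        · rw [h]; exact hX.last _
        · obtain ⟨j, hj⟩ := Fin.exists_castSucc_eq.2 h
          rw [← hj]; exact hX.bulk _ _) hX.indep
    have hflow := (rectChart m (n + 1)).measurePreserving_flow (m + (n + 1))
    simp only [← rectImageDens_flow] at hlaw
    have h1 := HasLaw.fun_comp (Y := (rectChart m (n + 1)).flow (m + (n + 1)))
      ⟨hflow.measurable.aemeasurable, map_withDensity_of_comp hflow (measurable_rectImageDens a a₁)⟩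
      hlaw
    have hφm : Measurable fun t : Fin m × Fin (n + 1) → ℝ => t ∘ rectOuter m n :=
      measurable_pi_lambda _ fun i => measurable_pi_apply _
    have h2 := HasLaw.fun_comp (Y := fun t => t ∘ rectOuter m n)
      ⟨hφm.aemeasurable, map_comp_withDensity rectOuter_injective (measurable_rectImageDens a a₁)
        (measurable_rectShapeDens a a₁) (lmarginal_rectImageDens a a₁)⟩ h1
    refine HasLaw.congr h2 (Filter.Eventually.of_forall fun ω => funext fun i => ?_)
    rcases i with l | l
    · have := congrFun ((rectChart m (n + 1)).gtRow_flow_left (rectLeft m (n + 1)) le_rfl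
        (fun l hl => (rectLeft_eq_iff le_rfl hl _).1 rfl) fun p => X p.1 p.2 ω) l
      rw [gtRow, pad_coe] at this
      exact this.symm
    · have := congrFun ((rectChart m (n + 1)).gtRow_flow_right (rectRight m (n + 1)) (Nat.le_succ n)
        (fun l hl => (rectRight_eq_iff (Nat.le_succ n) hl _).1 rfl) fun p => X p.1 p.2 ω) l
      rw [gtRow, pad_coe] at this
      exact this.symm

lemma ae_nonneg_of_expMeasure {Ω : Type*} [MeasurableSpace Ω] {P : Measure Ω} {Y : Ω → ℝ} {r : ℝ}
    (h : HasLaw Y (expMeasure r) P) : ∀ᵐ ω ∂P, 0 ≤ Y ω := by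
  have hm : Measurable (gammaPDF 1 r) := (measurable_gammaPDFReal 1 r).ennreal_ofReal
  rw [h.ae_iff (p := fun x => 0 ≤ x) (measurableSet_setOfPred.1 measurableSet_Ici),
    expMeasure, gammaMeasure, ae_withDensity_iff hm]
  refine Filter.Eventually.of_forall fun x hx => ?_
  by_contra hlt
  exact hx (gammaPDF_of_neg (not_le.1 hlt))

section RectDensity

variable {Ω : Type*} [MeasurableSpace Ω] {P : Measure Ω} {a a₁ : ℝ} {m n : ℕ}
  {X : Fin m → Fin (n + 1) → Ω → ℝ}

lemma IsRectExpMatrix.ae_displacement (hX : IsRectExpMatrix P a a₁ X) :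
    ∀ᵐ ω ∂P, ∀ l, displacement (fun i j => X i j ω) l =
        lam (zeroPad fun i j => X i j ω) m (n + 1) l ∧
      displacement (fun i (j : Fin n) => X i j.castSucc ω) l =
        lam (zeroPad fun i j => X i j ω) m n l := by
  have h : ∀ᵐ ω ∂P, ∀ i j, 0 ≤ X i j ω := by
    refine ae_all_iff.2 fun i => ae_all_iff.2 fun j => ?_
    induction j using Fin.lastCases with
    | last => exact ae_nonneg_of_expMeasure (hX.last i)
    | cast j => exact ae_nonneg_of_expMeasure (hX.bulk i j)
  filter_upwards [h] with ω hω l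
  refine ⟨displacement_eq_lam hω l, ?_⟩
  rw [displacement_eq_lam fun i j => hω i j.castSucc]
  refine lam_congr (fun i hi j hj => ?_) m le_rfl n le_rfl l
  rw [zeroPad, zeroPad, dif_pos ⟨hi, hj⟩, dif_pos ⟨hi, by omega⟩]
  rfl

/-- A pair of vectors without coinciding or vanishing coordinates. -/
structure GenericPair {k k' : ℕ} (x : Fin k → ℝ) (y : Fin k' → ℝ) : Prop where
  ne : ∀ i j, x i ≠ y j
  left_ne_zero : ∀ i, x i ≠ 0
  right_ne_zero : ∀ i, y i ≠ 0

theorem IsRectExpMatrix.hasDensity [IsProbabilityMeasure P] (hX : IsRectExpMatrix P a a₁ X)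
    (ha : 0 < a) (ha₁ : 0 < a + a₁) {k k' : ℕ} (hk : k = min m (n + 1)) (hk' : k' = min n m)
    (f : (Fin k → ℝ) × (Fin k' → ℝ) → ℝ)
    (hf : ∀ x y, GenericPair x y → gtDens m (n + 1) (pad x) *
      (rectWeight a a₁ m n (pad x) (pad y) * gtDens n m (pad y)) = ENNReal.ofReal (f (x, y))) :
    HasDensity P (fun ω => ((fun l : Fin k => displacement (fun i j => X i j ω) l),
      (fun l : Fin k' => displacement (fun i (j : Fin n) => X i j.castSucc ω) l))) f := by
  subst hk hk'
  have h := hasLaw_rectShape ha ha₁ hX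
  let e := MeasurableEquiv.sumPiEquivProdPi fun _ : Fin (min m (n + 1)) ⊕ Fin (min n m) => ℝ
  have he : MeasurePreserving e volume volume := volume_measurePreserving_sumPiEquivProdPi _
  have hd : rectShapeDens a a₁ m n =ᵐ[volume] fun v => ENNReal.ofReal (f (e v)) := by
    filter_upwards [ae_apply_ne] with v hv
    exact hf _ _ ⟨fun i j => hv.1 _ _ Sum.inl_ne_inr, fun i => hv.2 _, fun i => hv.2 _⟩
  rw [withDensity_congr_ae hd] at h
  refine HasDensity.congr_ae (HasDensity.comp_equiv (f := fun v => f (e v)) h e he f fun _ => rfl)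
    ?_ Filter.EventuallyEq.rfl
  filter_upwards [hX.ae_displacement] with ω hω
  exact Prod.ext (funext fun l => (hω l).1) (funext fun l => (hω l).2)

end RectDensity

lemma gtVol_pad {r K k : ℕ} (hk : k = min r K) (x : Fin k → ℝ) :
    gtVol r K (pad x) = superfact (r - K - 1) / superfact (r - 1) *
      ((∏ i, x i ^ (r - K)) * diffProd x) := by
  subst hk
  simp only [gtVol, pad_coe]

lemma sum_range_pad {k : ℕ} (x : Fin k → ℝ) : ∑ l ∈ Finset.range k, pad x l = ∑ i, x i := by
  rw [Finset.sum_range]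
  exact Finset.sum_congr rfl fun i _ => pad_coe x i

lemma rectDens_of_prec {a a₁ : ℝ} {m n k k' : ℕ} (ha : 0 < a) (ha₁ : 0 < a + a₁)
    (hk : k = min m (n + 1)) (hk' : k' = min n m) {x : Fin k → ℝ} {y : Fin k' → ℝ}
    (h : Prec (pad y) (pad x)) :
    gtDens m (n + 1) (pad x) * (rectWeight a a₁ m n (pad x) (pad y) * gtDens n m (pad y)) =
      ENNReal.ofReal (superfact (m - (n + 1) - 1) / superfact (m - 1) *
        ((∏ i, x i ^ (m - (n + 1))) * diffProd x) *
        ((2 * a) ^ (m * n) * (a + a₁) ^ m *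
          Real.exp (-((a + a₁) * ∑ i, x i + (a - a₁) * ∑ i, y i))) *
        (superfact (n - m - 1) / superfact (n - 1) * ((∏ i, y i ^ (n - m)) * diffProd y))) := by
  obtain ⟨h1, h2⟩ := h.dec (k := k) fun l hl => pad_of_le _ hl
  have p1 := gtVol_nonneg m (n + 1) h2
  rw [gtDens, gtDens, if_pos h1, if_pos h2, rectWeight, precInd_of_prec h, ← hk, ← hk',
    sum_range_pad, sum_range_pad, mul_one, ← ENNReal.ofReal_mul (by positivity),
    ← ENNReal.ofReal_mul p1, gtVol_pad hk, gtVol_pad hk']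
  simp only [mul_assoc]

lemma rectDens_of_not_prec {a a₁ : ℝ} {m n : ℕ} {x y : ℕ → ℝ} (h : ¬ Prec y x) :
    gtDens m (n + 1) x * (rectWeight a a₁ m n x y * gtDens n m y) = 0 := by
  rw [rectWeight, precInd_of_not_prec h, mul_zero, zero_mul, mul_zero]

lemma interlaced_iff_prec {n : ℕ} {x y : Fin n → ℝ} (h : GenericPair x y) :
    Interlaced x y ↔ Prec (pad y) (pad x) := by
  constructor
  · rintro ⟨h1, h2, h3⟩ l
    rcases lt_or_ge l n with hl | hl
    · rw [pad, pad, pad, dif_pos hl, dif_pos hl]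
      refine ⟨?_, (h1 _).le⟩
      split_ifs with hl'
      · exact (h2 _ _ rfl).le
      · exact (h3 _).le
    · rw [pad_of_le _ hl, pad_of_le _ hl, pad_of_le _ (by omega)]
      exact ⟨le_rfl, le_rfl⟩
  · intro hp
    have hd := (hp.dec (k := n) fun l hl => pad_of_le _ hl).1
    refine ⟨fun i => ?_, fun i j hij => ?_, fun i => ?_⟩
    · have := (hp i).2
      rw [pad_coe, pad_coe] at this
      exact this.lt_of_ne (h.ne i i).symm
    · have := (hp i).1
      rw [hij, pad_coe, pad_coe] at this
      exact this.lt_of_ne (h.ne j i)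
    · have := hd.2 i
      rw [pad_coe] at this
      exact this.lt_of_ne (h.right_ne_zero i).symm

lemma interlacedSucc_iff_prec {n : ℕ} {x : Fin (n + 1) → ℝ} {y : Fin n → ℝ}
    (h : GenericPair x y) : InterlacedSucc x y ↔ Prec (pad y) (pad x) := by
  constructor
  · rintro ⟨h1, h2, h3⟩ l
    rcases lt_or_ge l n with hl | hl
    · rw [pad, pad, pad, dif_pos hl, dif_pos (by omega), dif_pos (by omega)]
      exact ⟨(h2 ⟨l, hl⟩).le, (h1 ⟨l, hl⟩).le⟩
    · rw [pad_of_le _ hl, pad_of_le _ (by omega)]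
      refine ⟨le_rfl, ?_⟩
      rcases eq_or_lt_of_le hl with rfl | hl
      · exact h3.le.trans_eq (pad_coe x (Fin.last n)).symm
      · rw [pad_of_le _ hl]
  · intro hp
    have hd := (hp.dec (k := n + 1) fun l hl => pad_of_le _ hl).2
    refine ⟨fun i => ?_, fun i => ?_, ?_⟩
    · have := (hp i).2
      rw [pad_coe, show pad x i = x i.castSucc from pad_coe x i.castSucc] at this
      exact this.lt_of_ne (h.ne _ _).symm
    · have := (hp i).1
      rw [pad_coe, show pad x (i + 1) = x i.succ by rw [← pad_coe x i.succ]; rfl] at this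
      exact this.lt_of_ne (h.ne _ _)
    · have := hd.2 (Fin.last n)
      rw [pad_coe] at this
      exact this.lt_of_ne (h.left_ne_zero _).symm

lemma rectDens_eq_wideDensity {a a₁ : ℝ} {n₁ n₂ : ℕ} (ha : 0 < a) (ha₁ : 0 < a + a₁)
    (hn : n₁ ≤ n₂) (x y : Fin n₁ → ℝ) (h : GenericPair x y) :
    gtDens n₁ (n₂ + 1) (pad x) * (rectWeight a a₁ n₁ n₂ (pad x) (pad y) * gtDens n₂ n₁ (pad y)) =
      ENNReal.ofReal (wideDensity a a₁ n₁ n₂ (x, y)) := by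
  by_cases hI : Interlaced x y
  · rw [rectDens_of_prec ha ha₁ (by omega) (by omega) ((interlaced_iff_prec h).1 hI), wideDensity,
      Set.indicator_of_mem (by exact hI), show n₁ - (n₂ + 1) = 0 by omega]
    have e : -((a + a₁) * ∑ i, x i + (a - a₁) * ∑ i, y i) =
        -a * ∑ j, (x j + y j) + -a₁ * ∑ j, (x j - y j) := by
      rw [Finset.sum_add_distrib, Finset.sum_sub_distrib]; ring
    rw [e, Real.exp_add, show superfact (0 - 1) = 1 by simp [superfact]]
    simp only [pow_zero, Finset.prod_const_one]
    congr 1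
    have := (superfact_pos (n₁ - 1)).ne'
    have := (superfact_pos (n₂ - 1)).ne'
    field_simp
  · rw [rectDens_of_not_prec fun hp => hI ((interlaced_iff_prec h).2 hp), wideDensity,
      Set.indicator_of_notMem (by exact hI), ENNReal.ofReal_zero]

lemma rectDens_eq_tallDensity {a a₁ : ℝ} {n₁ n₂ : ℕ} (ha : 0 < a) (ha₁ : 0 < a + a₁)
    (hn : n₂ < n₁) (x : Fin (n₂ + 1) → ℝ) (y : Fin n₂ → ℝ) (h : GenericPair x y) :
    gtDens n₁ (n₂ + 1) (pad x) * (rectWeight a a₁ n₁ n₂ (pad x) (pad y) * gtDens n₂ n₁ (pad y)) =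
      ENNReal.ofReal (tallDensity a a₁ n₁ n₂ (x, y)) := by
  by_cases hI : InterlacedSucc x y
  · rw [rectDens_of_prec ha ha₁ (by omega) (by omega) ((interlacedSucc_iff_prec h).1 hI),
      tallDensity, Set.indicator_of_mem (by exact hI), show n₂ - n₁ = 0 by omega,
      show n₁ - (n₂ + 1) - 1 = n₁ - n₂ - 2 by omega, show n₁ - (n₂ + 1) = n₁ - n₂ - 1 by omega]
    have e : -((a + a₁) * ∑ i, x i + (a - a₁) * ∑ i, y i) =
        -a * ∑ j : Fin n₂, (x j.castSucc + y j) + -a₁ * ∑ j : Fin n₂, (x j.castSucc - y j) +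
          -(a + a₁) * x (Fin.last n₂) := by
      rw [Finset.sum_add_distrib, Finset.sum_sub_distrib, Fin.sum_univ_castSucc]; ring
    rw [e, Real.exp_add, Real.exp_add, show superfact (0 - 1) = 1 by simp [superfact]]
    simp only [pow_zero, Finset.prod_const_one]
    congr 1
    have := (superfact_pos (n₁ - 1)).ne'
    have := (superfact_pos (n₂ - 1)).ne'
    field_simp
  · rw [rectDens_of_not_prec fun hp => hI ((interlacedSucc_iff_prec h).2 hp), tallDensity,
      Set.indicator_of_notMem (by exact hI), ENNReal.ofReal_zero]

lemma diffProd_pos {k : ℕ} {x : Fin k → ℝ} (hx : StrictAnti x) : 0 < diffProd x :=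
  Finset.prod_pos fun _ _ => Finset.prod_pos fun _ hj => sub_pos.2 (hx (Finset.mem_Ioi.1 hj))

lemma Interlaced.strictAnti {n : ℕ} {x y : Fin n → ℝ} (h : Interlaced x y) :
    StrictAnti x ∧ StrictAnti y := by
  rcases n with _ | n
  · exact ⟨fun i => i.elim0, fun i => i.elim0⟩
  · rw [Fin.strictAnti_iff_succ_lt, Fin.strictAnti_iff_succ_lt]
    exact ⟨fun i => (h.2.1 i.castSucc i.succ (by simp)).trans (h.1 _),
      fun i => (h.1 _).trans (h.2.1 i.castSucc i.succ (by simp))⟩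

lemma InterlacedSucc.strictAnti {n : ℕ} {x : Fin (n + 1) → ℝ} {y : Fin n → ℝ}
    (h : InterlacedSucc x y) : StrictAnti x ∧ StrictAnti y := by
  constructor
  · rw [Fin.strictAnti_iff_succ_lt]
    exact fun i => (h.2.1 i).trans (h.1 i)
  · rcases n with _ | n
    · exact fun i => i.elim0
    · rw [Fin.strictAnti_iff_succ_lt]
      exact fun i => (h.1 i.succ).trans (by rw [← Fin.succ_castSucc]; exact h.2.1 i.castSucc)

lemma wideDensity_ne_zero_iff {a a₁ : ℝ} (ha : 0 < a) (ha₁ : 0 < a + a₁) (n₁ n₂ : ℕ)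
    (x y : Fin n₁ → ℝ) : wideDensity a a₁ n₁ n₂ (x, y) ≠ 0 ↔ Interlaced x y := by
  rw [wideDensity, Set.indicator_apply_ne_zero]
  refine ⟨fun h => h.1, fun h => ⟨h, ?_⟩⟩
  have h1 := diffProd_pos h.strictAnti.1
  have h2 := diffProd_pos h.strictAnti.2
  have h3 := superfact_pos (n₂ - n₁ - 1)
  have h4 := superfact_pos (n₁ - 1)
  have h5 := superfact_pos (n₂ - 1)
  have h6 : 0 < ∏ i, y i ^ (n₂ - n₁) := Finset.prod_pos fun i _ => pow_pos (h.2.2 i) _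
  rw [Function.mem_support]
  positivity

lemma tallDensity_ne_zero_iff {a a₁ : ℝ} (ha : 0 < a) (ha₁ : 0 < a + a₁) (n₁ n₂ : ℕ)
    (x : Fin (n₂ + 1) → ℝ) (y : Fin n₂ → ℝ) :
    tallDensity a a₁ n₁ n₂ (x, y) ≠ 0 ↔ InterlacedSucc x y := by
  rw [tallDensity, Set.indicator_apply_ne_zero]
  refine ⟨fun h => h.1, fun h => ⟨h, ?_⟩⟩
  have h1 := diffProd_pos h.strictAnti.1
  have h2 := diffProd_pos h.strictAnti.2
  have h3 := superfact_pos (n₁ - n₂ - 2)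
  have h4 := superfact_pos (n₁ - 1)
  have h5 := superfact_pos (n₂ - 1)
  have h6 : 0 < ∏ i, x i ^ (n₁ - n₂ - 1) := Finset.prod_pos fun i _ =>
    pow_pos (h.2.2.trans_le (h.strictAnti.1.antitone (Fin.le_last i))) _
  rw [Function.mem_support]
  positivity

/-! ### The symmetric case -/

/-- The sites carrying the shapes at the corners `(q, n)` in the symmetric case. -/
def symmSite (n : ℕ) [NeZero n] (q l : ℕ) : {p : Fin n × Fin n // p.1 ≤ p.2} :=
  ⟨(min (Fin.ofNat n (q - 1 - l)) (Fin.ofNat n (n - 1 - l)),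
    max (Fin.ofNat n (q - 1 - l)) (Fin.ofNat n (n - 1 - l))), min_le_max⟩

/-- The weight of a shape in the symmetric case. -/
def symmWeight (a a₁ : ℝ) (n : ℕ) (x : ℕ → ℝ) : ENNReal :=
  ENNReal.ofReal ((2 * a) ^ (n * (n - 1) / 2) * (a + a₁) ^ n *
    Real.exp (-(a * ∑ l ∈ Finset.range n, x l + a₁ * ∑ l ∈ Finset.range n, (-1) ^ l * x l)))

lemma measurable_symmWeight {α : Type*} [MeasurableSpace α] (a a₁ : ℝ) (n : ℕ) {x : α → ℕ → ℝ}
    (hx : ∀ l, Measurable fun a => x a l) : Measurable fun s => symmWeight a a₁ n (x s) := by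
  unfold symmWeight
  have h1 : Measurable fun s => ∑ l ∈ Finset.range n, x s l :=
    Finset.measurable_fun_sum _ fun l _ => hx l
  have h2 : Measurable fun s => ∑ l ∈ Finset.range n, (-1) ^ l * x s l :=
    Finset.measurable_fun_sum _ fun l _ => (hx l).const_mul _
  fun_prop

/-- The rates of the entries in the symmetric case. -/
def symmRate (a a₁ : ℝ) {n : ℕ} (p : {p : Fin n × Fin n // p.1 ≤ p.2}) : ℝ :=
  if p.1.1 = p.1.2 then a + a₁ else 2 * a

@[to_additive]
lemma prod_upperTriangle {M : Type*} [CommMonoid M] {n : ℕ} (f : Fin n → Fin n → M) :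
    ∏ p : {p : Fin n × Fin n // p.1 ≤ p.2}, f p.1.1 p.1.2 =
      ∏ i, (f i i * ∏ j ∈ Finset.Ioi i, f i j) := by
  rw [← Finset.prod_subtype (Finset.univ.filter fun p : Fin n × Fin n => p.1 ≤ p.2)
    (by simp) fun p => f p.1 p.2, Finset.prod_filter, Fintype.prod_prod_type]
  refine Finset.prod_congr rfl fun i _ => ?_
  rw [← Finset.prod_filter]
  have : Finset.univ.filter (fun j => i ≤ j) = insert i (Finset.Ioi i) := by
    ext j; simp [le_iff_eq_or_lt]
  rw [this, Finset.prod_insert (by simp)]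

lemma prod_symmRate (a a₁ : ℝ) (n : ℕ) :
    ∏ p : {p : Fin n × Fin n // p.1 ≤ p.2}, symmRate a a₁ p =
      (2 * a) ^ (n * (n - 1) / 2) * (a + a₁) ^ n := by
  have h := prod_upperTriangle fun i j : Fin n => if i = j then a + a₁ else 2 * a
  refine h.trans ?_
  have e : ∀ i : Fin n, ∏ j ∈ Finset.Ioi i, (if i = j then a + a₁ else 2 * a) =
      (2 * a) ^ (n - 1 - i) := fun i => by
    rw [← Fin.card_Ioi, ← Finset.prod_const]
    exact Finset.prod_congr rfl fun j hj => if_neg (Finset.mem_Ioi.1 hj).ne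
  simp only [e, if_true, Finset.prod_mul_distrib, Finset.prod_const, Finset.card_univ,
    Fintype.card_fin, Finset.prod_pow_eq_pow_sum]
  rw [mul_comm, ← Finset.sum_range fun i => n - 1 - i, Finset.sum_range_reflect fun i => i,
    Finset.sum_range_id]

lemma sum_symmRate (a a₁ : ℝ) {n : ℕ} {t : {p : Fin n × Fin n // p.1 ≤ p.2} → ℝ}
    (ht : ∀ p, 0 ≤ t p) : ∑ p, symmRate a a₁ p * t p =
      a * ∑ l ∈ Finset.range n, lam (zeroPad (symmMatrix t)) n n l +
      a₁ * ∑ l ∈ Finset.range n, (-1) ^ l * lam (zeroPad (symmMatrix t)) n n l := by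
  have hP := zeroPad_nonneg (X := symmMatrix t) fun i j => ht _
  rw [sum_lam hP n n (by omega),
    alternating_sum_lam hP (zeroPad_symm (symmMatrix_comm t)) n le_rfl]
  have h := sum_upperTriangle fun i j : Fin n =>
    (if i = j then a + a₁ else 2 * a) * symmMatrix t i j
  have e0 : ∀ p : {p : Fin n × Fin n // p.1 ≤ p.2}, t p = symmMatrix t p.1.1 p.1.2 := fun p => by
    rw [symmMatrix]
    congr 1
    exact Subtype.ext (Prod.ext (min_eq_left p.2).symm (max_eq_right p.2).symm)
  simp only [Finset.sum_range, zeroPad_coe]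
  have e1 : ∑ p, symmRate a a₁ p * t p = ∑ p : {p : Fin n × Fin n // p.1 ≤ p.2},
      (if p.1.1 = p.1.2 then a + a₁ else 2 * a) * symmMatrix t p.1.1 p.1.2 :=
    Finset.sum_congr rfl fun p _ => by rw [← e0]; rfl
  have e2 : ∀ i : Fin n, ∑ j ∈ Finset.Ioi i, (if i = j then a + a₁ else 2 * a) * symmMatrix t i j =
      a * ∑ j ∈ Finset.Ioi i, (symmMatrix t j i + symmMatrix t i j) := fun i => by
    rw [Finset.mul_sum]
    refine Finset.sum_congr rfl fun j hj => ?_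
    rw [if_neg (Finset.mem_Ioi.1 hj).ne, symmMatrix_comm t j i]
    ring
  have e3 : ∀ i : Fin n, ∑ j, symmMatrix t i j =
      symmMatrix t i i + ∑ j ∈ {i}ᶜ, symmMatrix t j i := fun i => by
    rw [Fintype.sum_eq_add_sum_compl i]
    congr 1
    exact Finset.sum_congr rfl fun j _ => symmMatrix_comm t i j
  rw [e1, h]
  simp only [if_true, e2, e3]
  rw [Finset.sum_add_distrib, ← Finset.mul_sum, ← Finset.mul_sum,
    Finset.sum_sum_Ioi_add_eq_sum_sum_off_diag, Finset.sum_add_distrib]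
  ring

section Symm

variable {n : ℕ} [NeZero n]

lemma symmSite_eq_iff {q l : ℕ} (hq : q ≤ n)
    (p : {p : Fin n × Fin n // p.1 ≤ p.2}) :
    symmSite n q l = p ↔ (p.1.1 : ℕ) = q - 1 - l ∧ (p.1.2 : ℕ) = n - 1 - l := by
  have h1 : (q - 1 - l) % n = q - 1 - l := Nat.mod_eq_of_lt (by omega)
  have h2 : (n - 1 - l) % n = n - 1 - l := Nat.mod_eq_of_lt (by omega)
  have h3 : Fin.ofNat n (q - 1 - l) ≤ Fin.ofNat n (n - 1 - l) := by
    rw [Fin.le_iff_val_le_val, Fin.val_ofNat, Fin.val_ofNat, h1, h2]; omega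
  rw [Subtype.ext_iff, Prod.ext_iff, Fin.ext_iff, Fin.ext_iff]
  simp only [symmSite, min_eq_left h3, max_eq_right h3, Fin.val_ofNat, h1, h2]
  exact and_congr eq_comm eq_comm

lemma distinctCoords_symmSite : DistinctCoords n (symmSite n) n := by
  intro q q' l l' hq hq' hl hl' h
  have h1 := (symmSite_eq_iff hq _).1 h
  have h2 := (symmSite_eq_iff (l := l') hq' _).1 rfl
  omega

lemma symmSite_injective : Function.Injective fun l : Fin n => symmSite n n l := fun a b h =>
  Fin.ext (distinctCoords_symmSite n n a b le_rfl le_rfl (by simp) (by simp) h).2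

lemma compl_image_symmSite :
    (Finset.univ.image fun l : Fin n => symmSite n n l)ᶜ = gtCoords n (symmSite n) n := by
  ext p
  rw [Finset.mem_compl, mem_gtCoords, Finset.mem_image]
  constructor
  · intro h
    have hp := p.2
    have hp2 := p.1.2.2
    rw [Fin.le_iff_val_le_val] at hp
    rcases eq_or_lt_of_le hp with he | hlt
    · refine absurd ⟨⟨n - 1 - p.1.2, by omega⟩, Finset.mem_univ _, ?_⟩ h
      exact (symmSite_eq_iff le_rfl p).2 ⟨by simp; omega, by simp; omega⟩
    · refine ⟨p.1.1 + (n - 1 - p.1.2) + 1, by omega, n - 1 - p.1.2, by omega, ?_⟩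
      exact (symmSite_eq_iff (by omega) p).2 ⟨by omega, by omega⟩
  · rintro ⟨q, hq, l, hl, he⟩ ⟨i, -, hi⟩
    have := (distinctCoords_symmSite q n l i hq.le le_rfl hl (by simp) (he.trans hi.symm)).1
    omega

/-- The density of the image of the symmetric matrix under the correspondence. -/
def symmImageDens (a a₁ : ℝ) (n : ℕ) [NeZero n]
    (s : {p : Fin n × Fin n // p.1 ≤ p.2} → ℝ) : ENNReal :=
  (∏ q ∈ Finset.range n, precInd (gtRow n (symmSite n) q s) (gtRow n (symmSite n) (q + 1) s)) *
    symmWeight a a₁ n (gtRow n (symmSite n) n s)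

lemma measurable_symmImageDens (a a₁ : ℝ) : Measurable (symmImageDens a a₁ n) :=
  (measurable_prod_precInd _ _ _).mul (measurable_symmWeight a a₁ n (measurable_gtRow _ _ _))

/-- The density of the shape at the corner `(n, n)` in the symmetric case. -/
def symmShapeDens (a a₁ : ℝ) (n : ℕ) (x : Fin n → ℝ) : ENNReal :=
  gtDens n n (pad x) * symmWeight a a₁ n (pad x)

omit [NeZero n] in
lemma measurable_symmShapeDens (a a₁ : ℝ) : Measurable (symmShapeDens a a₁ n) :=
  (measurable_gtDens _ _ measurable_pad).mul (measurable_symmWeight a a₁ n measurable_pad)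

lemma gtRow_symmSite (t : {p : Fin n × Fin n // p.1 ≤ p.2} → ℝ) :
    gtRow n (symmSite n) n t = pad (t ∘ fun l : Fin n => symmSite n n l) := by
  unfold gtRow
  rw [min_self]
  rfl

lemma lmarginal_symmImageDens (a a₁ : ℝ) (t : {p : Fin n × Fin n // p.1 ≤ p.2} → ℝ) :
    (∫⋯∫⁻_(Finset.univ.image fun l : Fin n => symmSite n n l)ᶜ, symmImageDens a a₁ n) t =
      symmShapeDens a a₁ n (t ∘ fun l : Fin n => symmSite n n l) := by
  rw [compl_image_symmSite]
  unfold symmImageDens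
  rw [lmarginal_mul_right (measurable_prod_precInd _ _ _), lmarginal_chain distinctCoords_symmSite,
    symmShapeDens, ← gtRow_symmSite]
  intro t t' h
  congr 1
  refine gtRow_congr fun l hl => h _ fun hmem => ?_
  obtain ⟨q', hq', l', hl', he'⟩ := mem_gtCoords.1 hmem
  have := (distinctCoords_symmSite q' n l' l hq'.le le_rfl hl' hl he').1
  omega

open Classical in
lemma symmImageDens_flow (a a₁ : ℝ) (t : {p : Fin n × Fin n // p.1 ≤ p.2} → ℝ) :
    symmImageDens a a₁ n ((symmChart n).flow (n + n) t) =
      if ∀ p, 0 ≤ t p then ENNReal.ofReal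
        ((∏ p : {p : Fin n × Fin n // p.1 ≤ p.2}, symmRate a a₁ p) *
        Real.exp (-∑ p, symmRate a a₁ p * t p)) else 0 := by
  set X := zeroPad (symmMatrix t) with hXdef
  have hA : ∀ q ≤ n, gtRow n (symmSite n) q ((symmChart n).flow (n + n) t) = lam X q n :=
    fun q hq => (symmChart n).gtRow_flow_left _ hq (fun l _ => (symmSite_eq_iff hq _).1 rfl) t
  have hsw : ∀ q, lam X n q = lam X q n := fun q => by
    funext l
    rw [← lam_swap]
    congr 1
    funext i j
    exact zeroPad_symm (symmMatrix_comm t) j i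
  have hiff : (∀ p, 0 ≤ t p) ↔ ∀ i < n, ∀ j < n, 0 ≤ X i j := by
    constructor
    · intro h i _ j _
      exact zeroPad_nonneg (fun _ _ => h _) i j
    · intro h p
      have := h p.1.1 p.1.1.2 p.1.2 p.1.2.2
      rwa [show X p.1.1 p.1.2 = t p from (symmChart n).emb_self t p] at this
  rw [← prec_boundary_iff] at hiff
  simp only [hsw, and_self] at hiff
  unfold symmImageDens
  rw [prod_precInd (fun q => gtRow n (symmSite n) q _), hA n le_rfl]
  have hcond : (∀ q < n, Prec (gtRow n (symmSite n) q ((symmChart n).flow (n + n) t))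
      (gtRow n (symmSite n) (q + 1) ((symmChart n).flow (n + n) t))) ↔ ∀ p, 0 ≤ t p := by
    rw [hiff]
    exact forall₂_congr fun q hq => by rw [hA q hq.le, hA (q + 1) hq]
  rw [if_congr hcond rfl rfl]
  split_ifs with ht
  · rw [one_mul, symmWeight, prod_symmRate, sum_symmRate a a₁ ht]
  · rw [zero_mul]

end Symm

section SymmDensity

variable {Ω : Type*} [MeasurableSpace Ω] {P : Measure Ω} {a a₁ : ℝ} {n : ℕ}
  {X : Fin n → Fin n → Ω → ℝ}

lemma IsSymmExpMatrix.symmMatrix_eq (hX : IsSymmExpMatrix P a a₁ X) (ω : Ω) :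
    (symmMatrix fun p => X p.1.1 p.1.2 ω) = fun i j => X i j ω := by
  funext i j
  rw [symmMatrix]
  rcases le_total i j with h | h
  · simp [h]
  · simp [h, hX.symm i j]

/-- The law of the shape of a random symmetric matrix. -/
theorem hasLaw_symmShape [IsProbabilityMeasure P] (ha : 0 < a) (ha₁ : 0 < a + a₁)
    (hX : IsSymmExpMatrix P a a₁ X) :
    HasLaw (fun ω (l : Fin n) => lam (zeroPad fun i j => X i j ω) n n l)
      (volume.withDensity (symmShapeDens a a₁ n)) P := by
  rcases Nat.eq_zero_or_pos n with rfl | hn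
  · refine hasLaw_of_isEmpty _ fun v => ?_
    have h1 : pad v = 0 := funext fun l => pad_of_le _ (by omega)
    rw [symmShapeDens, h1, gtDens_zero, symmWeight]
    simp
  · have : NeZero n := ⟨hn.ne'⟩
    have hlaw := hasLaw_expVector (P := P)
      (rate := fun p : {p : Fin n × Fin n // p.1 ≤ p.2} => symmRate a a₁ p)
      (Y := fun p => X p.1.1 p.1.2) (fun p => by unfold symmRate; split_ifs <;> linarith)
      (fun p => by
        unfold symmRate
        split_ifs with h
        · rw [← h]; exact hX.diag _
        · exact hX.offDiag _ _ (lt_of_le_of_ne p.2 h)) hX.indep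
    have hflow := (symmChart n).measurePreserving_flow (n + n)
    simp only [← symmImageDens_flow] at hlaw
    have h1 := HasLaw.fun_comp (Y := (symmChart n).flow (n + n))
      ⟨hflow.measurable.aemeasurable, map_withDensity_of_comp hflow (measurable_symmImageDens a a₁)⟩
      hlaw
    have hφm : Measurable fun t : {p : Fin n × Fin n // p.1 ≤ p.2} → ℝ =>
        t ∘ fun l : Fin n => symmSite n n l :=
      measurable_pi_lambda _ fun i => measurable_pi_apply _
    have h2 := HasLaw.fun_comp (Y := fun t => t ∘ fun l : Fin n => symmSite n n l)
      ⟨hφm.aemeasurable, map_comp_withDensity symmSite_injective (measurable_symmImageDens a a₁)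
        (measurable_symmShapeDens a a₁) (lmarginal_symmImageDens a a₁)⟩ h1
    refine HasLaw.congr h2 (Filter.Eventually.of_forall fun ω => funext fun l => ?_)
    have h3 := congrFun ((symmChart n).gtRow_flow_left (symmSite n) le_rfl
      (fun l _ => (symmSite_eq_iff le_rfl _).1 rfl) fun p => X p.1.1 p.1.2 ω) l
    rw [gtRow_symmSite, pad_coe] at h3
    have h4 : (symmChart n).emb (fun p => X p.1.1 p.1.2 ω) = zeroPad fun i j => X i j ω :=
      congrArg zeroPad (hX.symmMatrix_eq ω)
    rw [h4] at h3
    exact h3.symm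

lemma IsSymmExpMatrix.ae_displacement (hX : IsSymmExpMatrix P a a₁ X) :
    ∀ᵐ ω ∂P, ∀ l, displacement (fun i j => X i j ω) l =
        lam (zeroPad fun i j => X i j ω) n n l := by
  have h : ∀ᵐ ω ∂P, ∀ i j, 0 ≤ X i j ω := by
    refine ae_all_iff.2 fun i => ae_all_iff.2 fun j => ?_
    rcases lt_trichotomy i j with h | rfl | h
    · exact ae_nonneg_of_expMeasure (hX.offDiag i j h)
    · exact ae_nonneg_of_expMeasure (hX.diag i)
    · rw [hX.symm i j]
      exact ae_nonneg_of_expMeasure (hX.offDiag j i h)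
  filter_upwards [h] with ω hω l
  exact displacement_eq_lam hω l

lemma dec_pad_iff {x : Fin n → ℝ} (h1 : ∀ i j, i ≠ j → x i ≠ x j) (h2 : ∀ i, x i ≠ 0) :
    Dec (pad x) ↔ StrictAnti x ∧ ∀ i, 0 < x i := by
  constructor
  · intro h
    refine ⟨fun i j hij => lt_of_le_of_ne ?_ (h1 j i hij.ne'), fun i =>
      lt_of_le_of_ne ?_ (h2 i).symm⟩
    · have := h.1 (show (i : ℕ) ≤ j from hij.le)
      rwa [pad_coe, pad_coe] at this
    · have := h.2 i
      rwa [pad_coe] at this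
  · rintro ⟨ha, hp⟩
    have hnn : ∀ l, 0 ≤ pad x l := fun l => by
      unfold pad; split_ifs
      · exact (hp _).le
      · exact le_rfl
    refine ⟨fun i j hij => ?_, hnn⟩
    rcases lt_or_ge j n with hj | hj
    · rw [pad, pad, dif_pos hj, dif_pos (hij.trans_lt hj)]
      exact ha.antitone hij
    · rw [pad_of_le _ hj]
      exact hnn i

lemma symmShapeDens_eq (ha : 0 < a) (ha₁ : 0 < a + a₁) {x : Fin n → ℝ}
    (h1 : ∀ i j, i ≠ j → x i ≠ x j) (h2 : ∀ i, x i ≠ 0) :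
    symmShapeDens a a₁ n x = ENNReal.ofReal (symmDensity a a₁ n x) := by
  rw [symmShapeDens, gtDens, symmDensity]
  by_cases h : StrictAnti x ∧ ∀ i, 0 < x i
  · have hd := (dec_pad_iff h1 h2).2 h
    rw [if_pos hd, Set.indicator_of_mem (by exact h), symmWeight,
      ← ENNReal.ofReal_mul (gtVol_nonneg _ _ hd), gtVol_pad (min_self n).symm, Nat.sub_self,
      sum_range_pad]
    have e : ∑ l ∈ Finset.range n, (-1) ^ l * pad x l = ∑ j : Fin n, (-1) ^ (j : ℕ) * x j := by
      rw [Finset.sum_range]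
      exact Finset.sum_congr rfl fun j _ => by rw [pad_coe]
    rw [e, neg_add, Real.exp_add, ← neg_mul, ← neg_mul, show superfact (0 - 1) = 1 by simp [superfact]]
    simp only [pow_zero, Finset.prod_const_one]
    congr 1
    have := (superfact_pos (n - 1)).ne'
    field_simp
  · rw [if_neg fun hd => h ((dec_pad_iff h1 h2).1 hd), zero_mul,
      Set.indicator_of_notMem (by exact h), ENNReal.ofReal_zero]

theorem IsSymmExpMatrix.hasDensity [IsProbabilityMeasure P] (hX : IsSymmExpMatrix P a a₁ X)
    (ha : 0 < a) (ha₁ : 0 < a + a₁) :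
    HasDensity P (fun ω (l : Fin n) => displacement (fun i j => X i j ω) l)
      (symmDensity a a₁ n) := by
  have h := hasLaw_symmShape ha ha₁ hX
  have hd : symmShapeDens a a₁ n =ᵐ[volume] fun x => ENNReal.ofReal (symmDensity a a₁ n x) := by
    filter_upwards [ae_apply_ne] with x hx
    exact symmShapeDens_eq ha ha₁ hx.1 hx.2
  rw [withDensity_congr_ae hd] at h
  refine HasLaw.congr h ?_
  filter_upwards [hX.ae_displacement] with ω hω
  exact funext fun l => hω l

end SymmDensity

/-! ### The rescaled ensembles -/

lemma diffProd_smul {k : ℕ} (r : ℝ) (x : Fin k → ℝ) :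
    diffProd (r • x) = (∏ i : Fin k, ∏ _j ∈ Finset.Ioi i, r) * diffProd x := by
  simp only [diffProd, ← Finset.prod_mul_distrib, Pi.smul_apply, smul_eq_mul, mul_sub]

/-- The numbering of the coordinates of `x₁, y₁, x₂, y₂, …`. -/
def interleaveEquiv (n : ℕ) : Fin n ⊕ Fin n ≃ Fin (2 * n) where
  toFun := Sum.elim (fun j => ⟨2 * j, by omega⟩) (fun j => ⟨2 * j + 1, by omega⟩)
  invFun k := if (k : ℕ) % 2 = 0 then Sum.inl ⟨k / 2, by omega⟩ else Sum.inr ⟨k / 2, by omega⟩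
  left_inv := by
    rintro (j | j)
    · simp
    · have h1 : (2 * (j : ℕ) + 1) % 2 ≠ 0 := by omega
      have h2 : (2 * (j : ℕ) + 1) / 2 = j := by omega
      simp [h2]
  right_inv k := by
    ext
    dsimp only
    split_ifs with h <;> simp <;> omega

lemma sum_eq_sum_odd_even {n : ℕ} (f : Fin (2 * n) → ℝ) :
    ∑ k, f k = ∑ j, (oddPart f j + evenPart f j) := by
  rw [← (interleaveEquiv n).sum_comp, Fintype.sum_sum_type, Finset.sum_add_distrib]
  rfl

lemma ordered_smul_iff {k : ℕ} {r : ℝ} (hr : 0 < r) {x : Fin k → ℝ} (hx : ∀ i, x i ≠ 0) :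
    (StrictAnti (r • x) ∧ ∀ i, 0 < (r • x) i) ↔ (StrictAnti x ∧ ∀ i, 0 ≤ x i) := by
  refine and_congr ⟨fun h i j hij => ?_, fun h i j hij => ?_⟩ (forall_congr' fun i => ?_)
  · exact lt_of_mul_lt_mul_left (h hij) hr.le
  · exact mul_lt_mul_of_pos_left (h hij) hr
  · rw [Pi.smul_apply, smul_eq_mul, mul_pos_iff_of_pos_left hr]
    exact ⟨le_of_lt, fun h => h.lt_of_ne (hx i).symm⟩

section Exponents

variable {a : ℝ} (ha : 0 < a) (a₁ : ℝ) {n : ℕ} (x : Fin (2 * n) → ℝ)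
include ha

lemma exp_sum_rescaled : Real.exp (-a * ∑ j, ((2 * a)⁻¹ • x) j) = ∏ j, Real.exp (-x j / 2) := by
  rw [← Real.exp_sum]
  congr 1
  rw [Finset.mul_sum]
  refine Finset.sum_congr rfl fun j _ => ?_
  rw [Pi.smul_apply, smul_eq_mul]
  field_simp

lemma exp_sum_sub_rescaled :
    Real.exp (-a₁ * ∑ j, (oddPart ((2 * a)⁻¹ • x) j - evenPart ((2 * a)⁻¹ • x) j)) =
      ∏ j : Fin n, Real.exp (-a₁ / a * (oddPart x j - evenPart x j) / 2) := by
  rw [← Real.exp_sum]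
  congr 1
  rw [Finset.mul_sum]
  refine Finset.sum_congr rfl fun j _ => ?_
  simp only [oddPart, evenPart, Pi.smul_apply, smul_eq_mul]
  field_simp

end Exponents

theorem IsSymmExpMatrix.hasDensity_orthSympWeight {Ω : Type*} [MeasurableSpace Ω] {P : Measure Ω}
    [IsProbabilityMeasure P] {a a₁ : ℝ} {n : ℕ} {X : Fin (2 * n) → Fin (2 * n) → Ω → ℝ}
    (hX : IsSymmExpMatrix P a a₁ X) (ha : 0 < a) (ha₁ : 0 < a + a₁) :
    ∃ C : ℝ, HasDensity P
      (fun ω (l : Fin (2 * n)) => 2 * a * displacement (fun i j => X i j ω) l)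
      (fun x => 1 / C * orthSympWeight (-a₁ / a) n x) := by
  have h2a : 0 < 2 * a := by positivity
  have h := HasDensity.smul (hX.hasDensity ha ha₁) h2a
  refine ⟨1 / (((2 * a) ^ Fintype.card (Fin (2 * n)))⁻¹ *
    ((a + a₁) ^ (2 * n) * (2 * a) ^ (2 * n * (2 * n - 1) / 2) / superfact (2 * n - 1)) *
    ∏ i : Fin (2 * n), ∏ _j ∈ Finset.Ioi i, (2 * a)⁻¹),
    HasDensity.congr_ae h Filter.EventuallyEq.rfl ?_⟩
  filter_upwards [ae_apply_ne] with x hx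
  rw [one_div_one_div, symmDensity, orthSympWeight]
  have hiff := ordered_smul_iff (inv_pos.2 h2a) hx.2
  by_cases hm : StrictAnti x ∧ ∀ i, 0 ≤ x i
  · rw [Set.indicator_of_mem (by exact hiff.2 hm), Set.indicator_of_mem (by exact hm),
      exp_sum_rescaled ha, diffProd_smul]
    have e : ∑ j : Fin (2 * n), (-1) ^ (j : ℕ) * ((2 * a)⁻¹ • x) j =
        ∑ j, (oddPart ((2 * a)⁻¹ • x) j - evenPart ((2 * a)⁻¹ • x) j) := by
      rw [sum_eq_sum_odd_even]
      refine Finset.sum_congr rfl fun j _ => ?_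
      simp only [oddPart, evenPart, pow_succ, pow_mul]
      norm_num [sub_eq_add_neg]
    rw [e, exp_sum_sub_rescaled ha]
    ring
  · rw [Set.indicator_of_notMem (by exact fun h => hm (hiff.1 h)),
      Set.indicator_of_notMem (by exact hm), mul_zero, mul_zero]

lemma strictAnti_of_succ {N : ℕ} {z : Fin N → ℝ}
    (h : ∀ i j : Fin N, (i : ℕ) + 1 = j → z j < z i) : StrictAnti z := by
  rcases N with _ | N
  · exact fun i => i.elim0
  · exact Fin.strictAnti_iff_succ_lt.2 fun i => h _ _ (by simp)

lemma interlaced_odd_even_iff {n : ℕ} (z : Fin (2 * n) → ℝ) :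
    Interlaced (oddPart z) (evenPart z) ↔ StrictAnti z ∧ ∀ i, 0 < z i := by
  constructor
  · rintro ⟨h1, h2, h3⟩
    refine ⟨strictAnti_of_succ fun i j hij => ?_, fun i => ?_⟩
    · rcases Nat.even_or_odd' (i : ℕ) with ⟨c, hc | hc⟩
      · convert h1 ⟨c, by omega⟩ using 1
        · exact congrArg z (Fin.ext (by simp; omega))
        · exact congrArg z (Fin.ext (by simp; omega))
      · convert h2 ⟨c, by omega⟩ ⟨c + 1, by omega⟩ rfl using 1
        · exact congrArg z (Fin.ext (by simp; omega))
        · exact congrArg z (Fin.ext (by simp; omega))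
    · have h4 := h3 ⟨i / 2, by omega⟩
      rcases Nat.even_or_odd' (i : ℕ) with ⟨c, hc | hc⟩
      · refine (h4.trans (h1 _)).trans_eq (congrArg z (Fin.ext ?_))
        simp; omega
      · refine h4.trans_eq (congrArg z (Fin.ext ?_))
        simp; omega
  · rintro ⟨h1, h2⟩
    refine ⟨fun i => h1 ?_, fun i j hij => h1 ?_, fun i => h2 _⟩
    · rw [Fin.lt_def]; simp
    · rw [Fin.lt_def]; simp; omega

/-- Interleaving of two vectors. -/
def interleaveMeasurableEquiv (n : ℕ) :
    ((Fin n → ℝ) × (Fin n → ℝ)) ≃ᵐ (Fin (2 * n) → ℝ) :=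
  (MeasurableEquiv.sumPiEquivProdPi fun _ : Fin n ⊕ Fin n => ℝ).symm.trans
    (MeasurableEquiv.piCongrLeft (fun _ => ℝ) (interleaveEquiv n))

lemma measurePreserving_interleave (n : ℕ) :
    MeasurePreserving (interleaveMeasurableEquiv n) volume volume :=
  (volume_measurePreserving_piCongrLeft (fun _ => ℝ) (interleaveEquiv n)).comp
    (volume_measurePreserving_sumPiEquivProdPi_symm fun _ : Fin n ⊕ Fin n => ℝ)

lemma interleaveMeasurableEquiv_inl {n : ℕ} (p : (Fin n → ℝ) × (Fin n → ℝ)) (j : Fin n) :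
    interleaveMeasurableEquiv n p (interleaveEquiv n (Sum.inl j)) = p.1 j :=
  Equiv.piCongrLeft_apply_apply (fun _ : Fin (2 * n) => ℝ) (interleaveEquiv n) _ (Sum.inl j)

lemma interleaveMeasurableEquiv_inr {n : ℕ} (p : (Fin n → ℝ) × (Fin n → ℝ)) (j : Fin n) :
    interleaveMeasurableEquiv n p (interleaveEquiv n (Sum.inr j)) = p.2 j :=
  Equiv.piCongrLeft_apply_apply (fun _ : Fin (2 * n) => ℝ) (interleaveEquiv n) _ (Sum.inr j)

theorem IsRectExpMatrix.hasDensity_orthUnitWeight {Ω : Type*} [MeasurableSpace Ω] {P : Measure Ω}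
    [IsProbabilityMeasure P] {a a₁ : ℝ} {n : ℕ} {X : Fin n → Fin (n + 1) → Ω → ℝ}
    (hX : IsRectExpMatrix P a a₁ X) (ha : 0 < a) (ha₁ : 0 < a + a₁) :
    ∃ C : ℝ, HasDensity P
      (fun ω => interleave (n := n)
        (fun l => 2 * a * displacement (fun i j => X i j ω) l)
        (fun l => 2 * a * displacement (fun i (j : Fin n) => X i j.castSucc ω) l))
      (fun x => 1 / C * orthUnitWeight (-a₁ / a) n x) := by
  have h2a : 0 < 2 * a := by positivity
  have h0 := hX.hasDensity ha ha₁ (k := n) (k' := n) (by omega) (by omega) _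
    (rectDens_eq_wideDensity ha ha₁ le_rfl)
  have h1 := h0.comp_equiv (interleaveMeasurableEquiv n) (measurePreserving_interleave n)
    (fun z => wideDensity a a₁ n n (oddPart z, evenPart z)) fun p => by
      congr 1
      exact Prod.ext (funext fun j => interleaveMeasurableEquiv_inl p j)
        (funext fun j => interleaveMeasurableEquiv_inr p j)
  have h := h1.smul h2a
  refine ⟨1 / (((2 * a) ^ Fintype.card (Fin (2 * n)))⁻¹ *
    ((2 * a) ^ (n * n) * (a + a₁) ^ n / (superfact (n - 1) * superfact (n - 1))) *
    ((∏ i : Fin n, ∏ _j ∈ Finset.Ioi i, (2 * a)⁻¹) * (∏ i : Fin n, ∏ _j ∈ Finset.Ioi i, (2 * a)⁻¹)) *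
    ∏ i : Fin n, ∏ _j ∈ Finset.Ioi i, (-1)),
    HasDensity.congr_ae h (Filter.EventuallyEq.of_eq ?_) ?_⟩
  · funext ω k
    obtain ⟨s, rfl⟩ := (interleaveEquiv n).surjective k
    rw [Pi.smul_apply, smul_eq_mul]
    rcases s with j | j
    · rw [interleaveMeasurableEquiv_inl]
      simp [interleave, interleaveEquiv]
    · rw [interleaveMeasurableEquiv_inr]
      have e1 : (2 * (j : ℕ) + 1) % 2 = 1 := by omega
      have e2 : (2 * (j : ℕ) + 1) / 2 = j := by omega
      simp [interleave, interleaveEquiv, e1, e2]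
  · filter_upwards [ae_apply_ne] with x hx
    rw [one_div_one_div, wideDensity, orthUnitWeight]
    have hiff := (interlaced_odd_even_iff _).trans (ordered_smul_iff (inv_pos.2 h2a) hx.2)
    by_cases hm : StrictAnti x ∧ ∀ i, 0 ≤ x i
    · have e1 : diffProd (oddPart ((2 * a)⁻¹ • x)) =
          (∏ i : Fin n, ∏ _j ∈ Finset.Ioi i, (2 * a)⁻¹) * diffProd (oddPart x) :=
        diffProd_smul (2 * a)⁻¹ (oddPart x)
      have e2 : diffProd (evenPart ((2 * a)⁻¹ • x)) =
          (∏ i : Fin n, ∏ _j ∈ Finset.Ioi i, (2 * a)⁻¹) * diffProd (evenPart x) :=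
        diffProd_smul (2 * a)⁻¹ (evenPart x)
      have e3 : ∏ j : Fin n, ∏ k ∈ Finset.Ioi j,
          (oddPart x j - oddPart x k) * (evenPart x k - evenPart x j) =
          (∏ i : Fin n, ∏ _j ∈ Finset.Ioi i, (-1)) * (diffProd (oddPart x) * diffProd (evenPart x)) := by
        simp only [diffProd, ← Finset.prod_mul_distrib]
        refine Finset.prod_congr rfl fun i _ => Finset.prod_congr rfl fun j _ => ?_
        ring
      have e4 : (∏ i : Fin n, ∏ _j ∈ Finset.Ioi i, (-1 : ℝ)) *
          (∏ i : Fin n, ∏ _j ∈ Finset.Ioi i, (-1 : ℝ)) = 1 := by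
        simp only [← Finset.prod_mul_distrib]
        exact Finset.prod_eq_one fun i _ => Finset.prod_eq_one fun j _ => by norm_num
      rw [Set.indicator_of_mem (by exact hiff.2 hm), Set.indicator_of_mem (by exact hm),
        ← sum_eq_sum_odd_even, exp_sum_rescaled ha, exp_sum_sub_rescaled ha, e1, e2, e3,
        show n - n - 1 = 0 by omega, Nat.sub_self, show superfact 0 = 1 by simp [superfact]]
      simp only [pow_zero, Finset.prod_const_one]
      linear_combination (-(((2 * a) ^ Fintype.card (Fin (2 * n)))⁻¹ *
        ((2 * a) ^ (n * n) * (a + a₁) ^ n / (superfact (n - 1) * superfact (n - 1))) *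
        ((∏ i : Fin n, ∏ _j ∈ Finset.Ioi i, (2 * a)⁻¹) *
          (∏ i : Fin n, ∏ _j ∈ Finset.Ioi i, (2 * a)⁻¹)) * (∏ j, Real.exp (-x j / 2)) *
        (∏ j : Fin n, Real.exp (-a₁ / a * (oddPart x j - evenPart x j) / 2)) *
        (diffProd (oddPart x) * diffProd (evenPart x)))) * e4
    · rw [Set.indicator_of_notMem (by exact fun h => hm (hiff.1 h)),
        Set.indicator_of_notMem (by exact hm), mul_zero, mul_zero]

end ContinuousRSK

end

theorem mainTheorem9 {Ω : Type*} [MeasurableSpace Ω] (P : Measure Ω) [IsProbabilityMeasure P]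
    (a a₁ : ℝ) (ha : 0 < a) (ha₁ : 0 < a + a₁) :
    -- the symmetric square case: levels `1, …, n` have the stated density, the others are flat
    (∀ (n : ℕ) (X : Fin n → Fin n → Ω → ℝ), IsSymmExpMatrix P a a₁ X →
      HasDensity P
        (fun ω (l : Fin n) => displacement (fun i j => X i j ω) l)
        (symmDensity a a₁ n) ∧
      ∀ᵐ ω ∂P, ∀ l ≥ n, displacement (fun i j => X i j ω) l = 0) ∧
    -- the equivalence for even size: rescaled by `2 a`, with parameter `A = -a₁ / a`
    (∀ (n : ℕ) (X : Fin (2 * n) → Fin (2 * n) → Ω → ℝ), IsSymmExpMatrix P a a₁ X →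
      ∃ C : ℝ, HasDensity P
        (fun ω (l : Fin (2 * n)) => 2 * a * displacement (fun i j => X i j ω) l)
        (fun x => 1 / C * orthSympWeight (-a₁ / a) n x)) ∧
    -- the rectangular case with `n₁ ≤ n₂`
    (∀ n₁ n₂ : ℕ, n₁ ≤ n₂ →
      (∀ X : Fin n₁ → Fin (n₂ + 1) → Ω → ℝ, IsRectExpMatrix P a a₁ X →
        HasDensity P
          (fun ω =>
            ((fun l : Fin n₁ => displacement (fun i j => X i j ω) l),
              (fun l : Fin n₁ => displacement (fun i (j : Fin n₂) => X i j.castSucc ω) l)))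
          (wideDensity a a₁ n₁ n₂) ∧
        ∀ᵐ ω ∂P, ∀ l ≥ n₁, displacement (fun i j => X i j ω) l = 0 ∧
          displacement (fun i (j : Fin n₂) => X i j.castSucc ω) l = 0) ∧
      (∀ x y, wideDensity a a₁ n₁ n₂ (x, y) ≠ 0 ↔ Interlaced x y)) ∧
    -- the equivalence for `n₁ = n₂ = n`: rescaled by `2 a`, with parameter `A = -a₁ / a`
    (∀ (n : ℕ) (X : Fin n → Fin (n + 1) → Ω → ℝ), IsRectExpMatrix P a a₁ X →
      ∃ C : ℝ, HasDensity P
        (fun ω => interleave (n := n)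
          (fun l => 2 * a * displacement (fun i j => X i j ω) l)
          (fun l => 2 * a * displacement (fun i (j : Fin n) => X i j.castSucc ω) l))
        (fun x => 1 / C * orthUnitWeight (-a₁ / a) n x)) ∧
    -- the rectangular case with `n₂ < n₁`
    (∀ n₁ n₂ : ℕ, n₂ < n₁ →
      (∀ X : Fin n₁ → Fin (n₂ + 1) → Ω → ℝ, IsRectExpMatrix P a a₁ X →
        HasDensity P
          (fun ω =>
            ((fun l : Fin (n₂ + 1) => displacement (fun i j => X i j ω) l),
              (fun l : Fin n₂ => displacement (fun i (j : Fin n₂) => X i j.castSucc ω) l)))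
          (tallDensity a a₁ n₁ n₂) ∧
        ∀ᵐ ω ∂P, (∀ l ≥ n₂ + 1, displacement (fun i j => X i j ω) l = 0) ∧
          ∀ l ≥ n₂, displacement (fun i (j : Fin n₂) => X i j.castSucc ω) l = 0) ∧
      (∀ x y, tallDensity a a₁ n₁ n₂ (x, y) ≠ 0 ↔ InterlacedSucc x y)) := by
  refine ⟨fun n X hX => ⟨hX.hasDensity ha ha₁, ?_⟩,
    fun n X hX => hX.hasDensity_orthSympWeight ha ha₁,
    fun n₁ n₂ hn => ⟨fun X hX => ⟨?_, ?_⟩, wideDensity_ne_zero_iff ha ha₁ n₁ n₂⟩,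
    fun n X hX => hX.hasDensity_orthUnitWeight ha ha₁,
    fun n₁ n₂ hn => ⟨fun X hX => ⟨?_, ?_⟩, tallDensity_ne_zero_iff ha ha₁ n₁ n₂⟩⟩
  · filter_upwards [hX.ae_displacement] with ω hω l hl
    rw [hω, lam_eq_zero_of_le _ _ _ _ (by omega)]
  · exact hX.hasDensity ha ha₁ (by omega) (by omega) _ (rectDens_eq_wideDensity ha ha₁ hn)
  · filter_upwards [hX.ae_displacement] with ω hω l hl
    rw [(hω l).1, (hω l).2, lam_eq_zero_of_le _ _ _ _ (by omega),
      lam_eq_zero_of_le _ _ _ _ (by omega)]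
    exact ⟨rfl, rfl⟩
  · exact hX.hasDensity ha ha₁ (by omega) (by omega) _ (rectDens_eq_tallDensity ha ha₁ hn)
  · filter_upwards [hX.ae_displacement] with ω hω
    refine ⟨fun l hl => ?_, fun l hl => ?_⟩
    · rw [(hω l).1, lam_eq_zero_of_le _ _ _ _ (by omega)]
    · rw [(hω l).2, lam_eq_zero_of_le _ _ _ _ (by omega)]
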